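/- **Setting.** Let $n\ge 0$, let $Q$ and $U_0,\dots,U_{n-1}$ be finite-dimensional smooth (Hausdorff, boundaryless) manifolds, each with a smooth Riemannian metric, and let $\prod_i U_i$ carry the product metric. Let $\mathcal U_i\subseteq U_i$ and $S\subseteq Q$ be closed and $\mathcal U=\prod_i\mathcal U_i$. Let $F_i:Q\times U_i\to Q$ be of class $C^1$, and let $L_i:Q\times U_i\to\mathbb R$, $\ell:Q\to\mathbb R$ and $\kappa:Q\to\mathbb R$ be locally Lipschitz (Lipschitz in some chart around each point). For $(q_0,\mathbf u)\in Q\times\prod_i U_i$ the states are $q_{i}=F_{i-1}(q_{i-1},u_{i-1})$ for $1\le i\le n$, and $$J(q_0,\mathbf u)=\kappa(q_0)+\ell(q_n)+\sum_{i=0}^{n-1}L_i(q_i,u_i).$$ **Notions.** On a manifold $M$, the lower Dini derivative of a locally Lipschitz $f$ is $\underline Df(q;v)=\liminf_{\lambda\downarrow0}\frac{f(c(\lambda))-f(q)}{\lambda}$, with $c$ any smooth curve such that $c(0)=q$ and $c'(0)=v$. For lower semicontinuous $f:M\to\mathbb R\cup\{\infty\}$, $\partial_Ff(q)$ is the set of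 $dg(q)$ with $g\in C^1(M)$ such that $f-g$ has a local minimum at $q$; $\partial_Lf(q)$ is the set of limits in $T^*M$ of $p_k\in\partial_Ff(x_k)$ with $x_k\to q$ and $f(x_k)\to f(q)$; and $\partial_{L,u}f(q,u)$ denotes $\partial_L$ of $u\mapsto f(q,u)$. For closed $A\subseteq M$ and $q\in A$, $T_A^C(q)=\{v\in T_qM:\langle p,v\rangle\le0\ \ \forall p\in\partial_L\chi_A(q)\}$, where $\chi_A$ is $0$ on $A$ and $\infty$ off $A$. For $\Delta\ge0$, a pair $(q_0,\mathbf u)\in S\times\mathcal U$ is *$\Delta$-critical* for $J$ if for all $w\in T_S^C(q_0)$ and $\mathbf v\in T_{\mathcal U}^C(\mathbf u)$ $$-\Delta\left(\|w\|^2+\|\mathbf v\|^2\right)^{1/2}\le\underline DJ(q_0,\mathbf u;w,\mathbf v).$$ **Theorem.** Let $\Delta\ge0$ and let $(q_0,\mathbf u)\in S\times\mathcal U$ be $\Delta$-critical for $J$. Then there exist $a_i\in T^*_{q_i}Q$ $(0\le i\le n)$, $b_i\in T^*_{u_i}U_i$ $(0\le i\le n-1)$, costates $p_i\in T_{q_i}^*Q$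 $(0\le i\le n)$ and $\beta\in\partial_L\kappa(q_0)$ with $$(a_i,b_i)\in\partial_LL_i(q_i,u_i)\quad(0\le i\le n-1),\tag{1}$$ such that $$-p_n=a_n\in\partial_L\ell(q_n),\qquad p_{i-1}=-a_{i-1}+D_qF_{i-1}(q_{i-1},u_{i-1})^*p_i\quad(1\le i\le n),\tag{2}$$ $$-\Delta\|v\|\le\langle b_i-D_uF_i(q_i,u_i)^*p_{i+1},v\rangle\quad\text{for all }v\in T^C_{\mathcal U_i}(u_i)\quad(0\le i\le n-1),\tag{3}$$ $$-\Delta\|v\|\le\langle\beta-p_0,v\rangle\quad\text{for all }v\in T_S^C(q_0).\tag{4}$$ Moreover there also exist (in general different) $a_i$, $b_i$, $p_i$ and $\beta\in\partial_L\kappa(q_0)$ satisfying (2), (3), (4) in which, for $n\ge1$, the inclusion (1) for $i=0$ is replaced by $b_0\in\partial_{L,u}L_0(q_0,u_0)$ (with $a_0\in T^*_{q_0}Q$ unrestricted), while (1) holds for $1\le i\le n-1$. -/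

import Mathlib

open Set Filter Topology Bundle
open scoped Manifold ContDiff NNReal

noncomputable section

namespace DiscreteGeometricControl

/-! ### Finite products of manifolds -/

section PiManifold

/-- A finite product of manifolds, with product charts, is a manifold. -/
instance isManifold_pi {ι : Type*} [Fintype ι] {E : ι → Type*} [∀ i, NormedAddCommGroup (E i)]
    [∀ i, NormedSpace ℝ (E i)] {H : ι → Type*} [∀ i, TopologicalSpace (H i)]
    {M : ι → Type*} [∀ i, TopologicalSpace (M i)] [∀ i, ChartedSpace (H i) (M i)]
    (I : ∀ i, ModelWithCorners ℝ (E i) (H i)) (m : ℕ∞ω) [∀ i, IsManifold (I i) m (M i)] :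
    IsManifold (ModelWithCorners.pi I) m (∀ i, M i) := by
  refine isManifold_of_contDiffOn _ m _ ?_
  rintro _ _ ⟨f, hf, rfl⟩ ⟨f', hf', rfl⟩
  rw [contDiffOn_pi]
  intro i
  have hg := (contDiffGroupoid m (I i)).compatible (hf i (mem_univ i)) (hf' i (mem_univ i))
  have h : ContDiffOn ℝ m (I i ∘ ((f i).symm ≫ₕ f' i) ∘ (I i).symm)
      ((I i).symm ⁻¹' ((f i).symm ≫ₕ f' i).source ∩ range (I i)) := hg.1
  refine h.comp (t := _) ((ContinuousLinearMap.proj (R := ℝ) (φ := E) i).contDiff.contDiffOn) ?_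
  rintro x ⟨hx, y, rfl⟩
  refine ⟨?_, y i, rfl⟩
  have h1 := hx.1 i (mem_univ i)
  have h2 := hx.2 i (mem_univ i)
  exact ⟨h1, h2⟩

end PiManifold

/-! ### Nonsmooth analysis on manifolds -/

section Nonsmooth

variable {E : Type*} [NormedAddCommGroup E] [NormedSpace ℝ E] {H : Type*} [TopologicalSpace H]
  (I : ModelWithCorners ℝ E H) {M : Type*} [TopologicalSpace M] [ChartedSpace H M]

/-- The cotangent space `T_q^* M`. -/
abbrev Cotangent (q : M) : Type _ := TangentSpace I q →L[ℝ] Bundle.Trivial M ℝ q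

/-- `f` is locally Lipschitz: around every point there is a chart of the smooth structure in which
`f` is Lipschitz. -/
def IsLocallyLipschitz (f : M → ℝ) : Prop :=
  ∀ q : M, ∃ e ∈ IsManifold.maximalAtlas I ∞ M, q ∈ e.source ∧
    ∃ K : ℝ≥0, LipschitzOnWith K (f ∘ (e.extend I).symm) (e.extend I).target

/-- The lower Dini derivative `liminf_{t ↓ 0} (f (c t) - f q) / t`, where `c` is a smooth curve
with `c 0 = q` and `c' 0 = v`. For locally Lipschitz `f` the value does not depend on the curve;
the definition takes the infimum over all such curves. -/
def lowerDini (f : M → ℝ) (q : M) (v : TangentSpace I q) : EReal :=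
  ⨅ (c : ℝ → M) (_ : ContMDiff 𝓘(ℝ, ℝ) I ∞ c)
    (_ : (⟨c 0, mfderiv 𝓘(ℝ, ℝ) I c 0 (1 : ℝ)⟩ : TangentBundle I M) = ⟨q, v⟩),
    liminf (fun t : ℝ => (((f (c t) - f q) / t : ℝ) : EReal)) (𝓝[>] 0)

/-- The Fréchet subdifferential: all `p = dg(q)` with `g : M → ℝ` of class `C^1` such that `f - g`
has a local minimum at `q`. -/
def frechetSubdiff (f : M → EReal) (q : M) : Set (Cotangent I q) :=
  {p | ∃ g : M → ℝ, ContMDiff I 𝓘(ℝ, ℝ) 1 g ∧ p = mfderiv I 𝓘(ℝ, ℝ) g q ∧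
    IsLocalMin (fun x => f x - (g x : EReal)) q}

/-- The limiting subdifferential: limits, in the cotangent bundle, of Fréchet subgradients `P k` at
points `x k → q` with `f (x k) → f q`. -/
def limitingSubdiff [IsManifold I 1 M] (f : M → EReal) (q : M) : Set (Cotangent I q) :=
  {p | ∃ (x : ℕ → M) (P : ∀ k, Cotangent I (x k)), (∀ k, P k ∈ frechetSubdiff I f (x k)) ∧
    Tendsto (fun k => f (x k)) atTop (𝓝 (f q)) ∧
    Tendsto (fun k => (⟨x k, P k⟩ : TotalSpace (E →L[ℝ] ℝ) (fun y : M => Cotangent I y))) atTop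
      (𝓝 ⟨q, p⟩)}

/-- The limiting subdifferential of a real-valued function. -/
abbrev limitingSubdiffReal [IsManifold I 1 M] (f : M → ℝ) (q : M) : Set (Cotangent I q) :=
  limitingSubdiff I (fun x => (f x : EReal)) q

open Classical in
/-- The characteristic function of `S`: `0` on `S` and `∞` off `S`. -/
def charFun (S : Set M) (x : M) : EReal := if x ∈ S then 0 else ⊤

/-- The limiting normal cone to `S`. -/
def limitingNormalCone [IsManifold I 1 M] (S : Set M) (q : M) : Set (Cotangent I q) :=
  limitingSubdiff I (charFun S) q

/-- The Clarke tangent cone to `S`, the polar of the limiting normal cone. -/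
def clarkeTangentCone [IsManifold I 1 M] (S : Set M) (q : M) : Set (TangentSpace I q) :=
  {v | ∀ p ∈ limitingNormalCone I S q, (p v : ℝ) ≤ 0}

end Nonsmooth

/-! ### Discrete-time geometric control problems -/

/-- The data of a discrete-time geometric control problem with variable initial state: update maps
`F i : Q × U i → Q`, control sets, stage costs `L i`, terminal cost `ℓ`, initial cost `κ` and
initial set `S`. -/
structure ControlProblem (n : ℕ) (Q : Type*) (U : Fin n → Type*) where
  F : ∀ i, Q × U i → Q
  controlSet : ∀ i, Set (U i)
  L : ∀ i, Q × U i → ℝ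
  ℓ : Q → ℝ
  κ : Q → ℝ
  S : Set Q

/-- A smooth Riemannian metric on a manifold without boundary modelled on `E`. -/
abbrev SmoothMetric (E : Type*) [NormedAddCommGroup E] [NormedSpace ℝ E]
    (M : Type*) [TopologicalSpace M] [ChartedSpace E M] [IsManifold 𝓘(ℝ, E) ∞ M] : Type _ :=
  ContMDiffRiemannianMetric 𝓘(ℝ, E) ∞ E (fun x : M => TangentSpace 𝓘(ℝ, E) x)

namespace ControlProblem

section Basic

variable {n : ℕ} {Q : Type*} {U : Fin n → Type*} (P : ControlProblem n Q U)

/-- The set `𝒰` of control sequences. -/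
def controls : Set (∀ i, U i) := Set.univ.pi P.controlSet

/-- The state sequence `q_0, …, q_n` with `q_{i+1} = F_i (q_i, u_i)`. -/
def state (q₀ : Q) (u : ∀ i, U i) : Fin (n + 1) → Q :=
  Fin.induction q₀ (fun i q => P.F i (q, u i))

/-- The cost `κ(q_0) + ℓ(q_n) + ∑ L_i(q_i, u_i)` as a function of `(q_0, u)`. -/
def cost (x : Q × (∀ i, U i)) : ℝ :=
  P.κ x.1 + P.ℓ (P.state x.1 x.2 (Fin.last n)) +
    ∑ i : Fin n, P.L i (P.state x.1 x.2 i.castSucc, x.2 i)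

end Basic

section Geometric

variable {n : ℕ} {EQ : Type*} [NormedAddCommGroup EQ] [NormedSpace ℝ EQ]
  {Q : Type*} [TopologicalSpace Q] [ChartedSpace EQ Q] [IsManifold 𝓘(ℝ, EQ) ∞ Q]
  {EU : Fin n → Type*} [∀ i, NormedAddCommGroup (EU i)] [∀ i, NormedSpace ℝ (EU i)]
  {U : Fin n → Type*} [∀ i, TopologicalSpace (U i)] [∀ i, ChartedSpace (EU i) (U i)]
  [∀ i, IsManifold 𝓘(ℝ, EU i) ∞ (U i)]
  (P : ControlProblem n Q U)

variable (EQ EU) in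
/-- The sets `S` and `𝒰_i` are closed, the maps `F_i` are `C^1`, and all costs are locally
Lipschitz. -/
structure Regular : Prop where
  isClosed_S : IsClosed P.S
  isClosed_controlSet : ∀ i, IsClosed (P.controlSet i)
  contMDiff_F : ∀ i, ContMDiff (𝓘(ℝ, EQ).prod 𝓘(ℝ, EU i)) 𝓘(ℝ, EQ) 1 (P.F i)
  lipschitz_L : ∀ i, IsLocallyLipschitz (𝓘(ℝ, EQ).prod 𝓘(ℝ, EU i)) (P.L i)
  lipschitz_ℓ : IsLocallyLipschitz 𝓘(ℝ, EQ) P.ℓ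
  lipschitz_κ : IsLocallyLipschitz 𝓘(ℝ, EQ) P.κ

variable (gQ : SmoothMetric EQ Q) (g : ∀ i, SmoothMetric (EU i) (U i))

/-- `(q₀, u)` is `Δ`-critical: `-Δ (‖w‖² + ‖v‖²)^{1/2}` is at most the lower Dini derivative of the
cost at `(q₀, u)` in direction `(w, v)` for all Clarke tangent vectors `w` to `S` at `q₀` and `v` to
`𝒰` at `u`. Here `‖v‖² = ∑ ‖v_i‖²` is taken in the product metric. -/
def IsCritical (Δ : ℝ) (q₀ : Q) (u : ∀ i, U i) : Prop :=
  ∀ w ∈ clarkeTangentCone 𝓘(ℝ, EQ) P.S q₀,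
  ∀ v ∈ clarkeTangentCone (ModelWithCorners.pi fun i => 𝓘(ℝ, EU i)) P.controls u,
    ((-Δ * √(gQ.inner q₀ w w + ∑ i, (g i).inner (u i) (v i) (v i)) : ℝ) : EReal) ≤
      lowerDini (𝓘(ℝ, EQ).prod (ModelWithCorners.pi fun i => 𝓘(ℝ, EU i))) P.cost (q₀, u) (w, v)

/-- The partial derivative `D_q F_i (q_i, u_i)` along the state sequence. -/
def DqF (q₀ : Q) (u : ∀ i, U i) (i : Fin n) :
    TangentSpace 𝓘(ℝ, EQ) (P.state q₀ u i.castSucc) →L[ℝ]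
      TangentSpace 𝓘(ℝ, EQ) (P.state q₀ u i.succ) :=
  mfderiv 𝓘(ℝ, EQ) 𝓘(ℝ, EQ) (fun q => P.F i (q, u i)) (P.state q₀ u i.castSucc)

/-- The partial derivative `D_u F_i (q_i, u_i)` along the state sequence. -/
def DuF (q₀ : Q) (u : ∀ i, U i) (i : Fin n) :
    TangentSpace 𝓘(ℝ, EU i) (u i) →L[ℝ] TangentSpace 𝓘(ℝ, EQ) (P.state q₀ u i.succ) :=
  mfderiv 𝓘(ℝ, EU i) 𝓘(ℝ, EQ) (fun c => P.F i (P.state q₀ u i.castSucc, c)) (u i)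

/-- The covector `(a, b)` on `T_q Q × T_c U_i`, acting by `(w, v) ↦ a w + b v`. -/
def pairCovector {i : Fin n} {q : Q} {c : U i} (a : Cotangent 𝓘(ℝ, EQ) q)
    (b : Cotangent 𝓘(ℝ, EU i) c) : Cotangent (𝓘(ℝ, EQ).prod 𝓘(ℝ, EU i)) (q, c) :=
  ContinuousLinearMap.coprod (M₁ := TangentSpace 𝓘(ℝ, EQ) q) (M₂ := TangentSpace 𝓘(ℝ, EU i) c)
    (M := ℝ) a b

/-- The endpoint condition, the adjoint equations, the stationarity conditions and the condition on
the initial costate, for sequences `a_0, …, a_n`, `b_0, …, b_{n-1}`, costates `p_0, …, p_n` and a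
covector `β` at the initial state. -/
structure CostateConditions (Δ : ℝ) (q₀ : Q) (u : ∀ i, U i)
    (a : ∀ j, Cotangent 𝓘(ℝ, EQ) (P.state q₀ u j)) (b : ∀ i, Cotangent 𝓘(ℝ, EU i) (u i))
    (p : ∀ j, Cotangent 𝓘(ℝ, EQ) (P.state q₀ u j)) (β : Cotangent 𝓘(ℝ, EQ) q₀) : Prop where
  a_last : a (Fin.last n) ∈ limitingSubdiffReal 𝓘(ℝ, EQ) P.ℓ (P.state q₀ u (Fin.last n))
  endpoint : -p (Fin.last n) = a (Fin.last n)
  adjoint : ∀ i : Fin n, p i.castSucc = -a i.castSucc + (p i.succ).comp (P.DqF q₀ u i)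
  stationary : ∀ i : Fin n, ∀ v ∈ clarkeTangentCone 𝓘(ℝ, EU i) (P.controlSet i) (u i),
    -Δ * √((g i).inner (u i) v v) ≤ (b i v : ℝ) - (p i.succ (P.DuF q₀ u i v) : ℝ)
  β_mem : β ∈ limitingSubdiffReal 𝓘(ℝ, EQ) P.κ q₀
  initial : ∀ v ∈ clarkeTangentCone 𝓘(ℝ, EQ) P.S q₀,
    -Δ * √(gQ.inner q₀ v v) ≤ (β v : ℝ) - (p 0 v : ℝ)

end Geometric

end ControlProblem

end DiscreteGeometricControl

end

/-! In charts the cost is, to first order, `f ∘ A`: here `f` is the sum of κ, ℓ and the L_i, each in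
a variable of its own, and `A` is the derivative of (q_0, u) ↦ (q_0, q_n, (q_i, u_i)). The terms are
Lipschitz, so difference quotients along curves depend in the limit only on velocities. Criticality
thus says that the lower Dini derivative of `f` in direction `A v` is at least `-N v` for `v` in
`K`, where `N` is Δ times the product norm and `K` is the product of the Clarke cones. As a product
of polars `K` is a closed convex cone, and it lies in the Clarke cone of S × 𝒰 factor by factor
(`mem_clarkeTangentCone_pi`).

The Dini derivative need not be convex, so a covector is not obtained by separation. Instead
`exists_almost_stationary_smoothSubgradient` minimises a rescaled `f` at `z`, plus `N v`, plus a
penalty `M |z - A v|²` and a small multiple of `|v|²`, over `v` in `K` and `z` in a ball. Minimality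
in `z` makes the negative penalty gradient a subgradient of `f` near the base point; minimality in
`v` bounds the same covector below along `A K`. The Lipschitz constant bounds these covectors, and a
limit `p` satisfies `-N ≤ p ∘ A` on `K`. Since `f` is separated, `p` restricts to a limiting
subgradient of each term (`IsLimitingSubgradient.restrict`).

Summation by parts along the adjoint equation (`exists_adjoint_solution`) turns `p ∘ A` into a sum
with one term for the initial state and one for each control. Vectors supported in a single factor
then give the individual conditions.

For the second assertion L_0 is frozen at q_0 and only the controls vary. The costate p_0 is set
equal to β, which makes the initial condition trivial, and the adjoint equation then defines a_0. -/

namespace DiscreteGeometricControl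

/-! ### Smooth and limiting subgradients on normed spaces, and their restriction to summands. -/

section SmoothSubgradient

variable {E : Type*} [NormedAddCommGroup E] [NormedSpace ℝ E]

/-- `ξ` is the derivative at `x` of a smooth function touching `f` from below at `x`. -/
def IsSmoothSubgradient (f : E → ℝ) (x : E) (ξ : E →L[ℝ] ℝ) : Prop :=
  ∃ g : E → ℝ, ContDiff ℝ ∞ g ∧ fderiv ℝ g x = ξ ∧ IsLocalMin (fun z => f z - g z) x

/-- `p` is a limit of smooth subgradients of `f` at points tending to `y`. -/
def IsLimitingSubgradient (f : E → ℝ) (y : E) (p : E →L[ℝ] ℝ) : Prop :=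
  ∃ (x : ℕ → E) (ξ : ℕ → E →L[ℝ] ℝ), (∀ k, IsSmoothSubgradient f (x k) (ξ k)) ∧
    Tendsto x atTop (𝓝 y) ∧ Tendsto ξ atTop (𝓝 p)

variable {E₁ : Type*} [NormedAddCommGroup E₁] [NormedSpace ℝ E₁]

/-- If `f` splits, along the affine spaces `x + range i`, as a function of `pr` plus a constant,
its smooth subgradients restrict to smooth subgradients of that function. -/
theorem IsSmoothSubgradient.restrict {f : E → ℝ} {f₁ : E₁ → ℝ} {pr : E →L[ℝ] E₁} {i : E₁ →L[ℝ] E}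
    (hf : ∀ x h, f (x + i h) - f x = f₁ (pr x + h) - f₁ (pr x)) {x : E} {ξ : E →L[ℝ] ℝ}
    (h : IsSmoothSubgradient f x ξ) : IsSmoothSubgradient f₁ (pr x) (ξ.comp i) := by
  obtain ⟨g, hg, rfl, hmin⟩ := h
  have hd : HasFDerivAt (fun z : E₁ => x + i (z - pr x)) i (pr x) := by
    have h1 : HasFDerivAt (fun z : E₁ => z - pr x) (.id ℝ E₁) (pr x) :=
      (hasFDerivAt_id (pr x)).sub_const (pr x)
    exact (i.hasFDerivAt.comp (pr x) h1).const_add x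
  have hx : x + i (pr x - pr x) = x := by simp
  -- The affine map z ↦ x + i (z - pr x) sends `pr x` to `x`, and along it `f` and `f₁` differ by a
  -- constant.
  refine ⟨fun z => g (x + i (z - pr x)), ?_, ?_, ?_⟩
  · exact hg.comp (contDiff_const.add (i.contDiff.comp (contDiff_id.sub contDiff_const)))
  · have hgd : HasFDerivAt g (fderiv ℝ g x) (x + i (pr x - pr x)) := by
      rw [hx]; exact (hg.differentiable (by simp) x).hasFDerivAt
    exact (hgd.comp (pr x) hd).fderiv
  · have hc : Tendsto (fun z : E₁ => x + i (z - pr x)) (𝓝 (pr x)) (𝓝 x) := by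
      have := hd.continuousAt.tendsto
      rwa [hx] at this
    filter_upwards [hc.eventually hmin] with z hz
    have := hf x (z - pr x)
    simp only [add_sub_cancel, sub_self, map_zero, add_zero] at this hz ⊢
    linarith

theorem IsLimitingSubgradient.restrict {f : E → ℝ} {f₁ : E₁ → ℝ} {pr : E →L[ℝ] E₁}
    {i : E₁ →L[ℝ] E} (hf : ∀ x h, f (x + i h) - f x = f₁ (pr x + h) - f₁ (pr x)) {y : E}
    {p : E →L[ℝ] ℝ} (h : IsLimitingSubgradient f y p) :
    IsLimitingSubgradient f₁ (pr y) (p.comp i) := by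
  obtain ⟨x, ξ, hξ, hx, hp⟩ := h
  exact ⟨fun k => pr (x k), fun k => (ξ k).comp i, fun k => (hξ k).restrict hf,
    (pr.continuous.tendsto y).comp hx,
    (((ContinuousLinearMap.compL ℝ E₁ E ℝ).flip i).continuous.tendsto p).comp hp⟩

end SmoothSubgradient

/-! ### Penalised minimisation and the existence of a stationary limiting subgradient. -/

section Decoupling

theorem nonneg_of_mul_add_sq_nonneg {a b r : ℝ} (hr : 0 < r)
    (h : ∀ s, 0 < s → s < r → 0 ≤ s * a + s ^ 2 * b) : 0 ≤ a := by
  have ht : Tendsto (fun s : ℝ => a + s * b) (𝓝[>] 0) (𝓝 a) := by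
    have : Tendsto (fun s : ℝ => a + s * b) (𝓝 0) (𝓝 (a + 0 * b)) :=
      (continuous_const.add (continuous_id.mul continuous_const)).tendsto 0
    simpa using this.mono_left nhdsWithin_le_nhds
  refine ge_of_tendsto ht ?_
  filter_upwards [Ioo_mem_nhdsGT hr] with s hs
  have := h s hs.1 hs.2
  have h2 : 0 ≤ s * (a + s * b) := by nlinarith
  exact nonneg_of_mul_nonneg_right h2 hs.1

/-- With m = M d the hypothesis becomes m² + M η s² ≤ 1 + c m, which fails for m > c + 1. Neither
bound depends on `M`: the penalty gradient, of size M d, stays bounded while d and s are forced to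
be small for large M. -/
theorem penalty_estimates {M η c d s : ℝ} (hM : 0 < M) (hη : 0 ≤ η) (hc : 0 ≤ c) (hd : 0 ≤ d)
    (h : M * d ^ 2 + η * s ^ 2 ≤ 1 / M + c * d) :
    M * d ≤ c + 1 ∧ M * (η * s ^ 2) ≤ (c + 1) ^ 2 := by
  have h1 := mul_le_mul_of_nonneg_left h hM.le
  have h2 : M * (1 / M + c * d) = 1 + c * (M * d) := by field_simp
  have h3 : M * (M * d ^ 2 + η * s ^ 2) = (M * d) ^ 2 + M * (η * s ^ 2) := by ring
  rw [h2, h3] at h1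
  have h4 : 0 ≤ M * (η * s ^ 2) := by positivity
  have h5 : 0 ≤ M * d := by positivity
  generalize M * d = m at *
  have h6 : m ≤ c + 1 := by
    by_contra! hlt
    nlinarith
  exact ⟨h6, by nlinarith⟩

variable {V E : Type*} [NormedAddCommGroup V] [NormedSpace ℝ V] [FiniteDimensional ℝ V]
  [NormedAddCommGroup E] [NormedSpace ℝ E]

/-- Makes the directional estimates uniform on the compact unit part of `K`. An estimate at `v`
spreads to nearby directions at a cost of ε/3 each for the estimate itself, the continuity of `N`
and the Lipschitz bound on `f`. -/
theorem eventually_forall_quotient_ge {K : Set V} (hK : IsClosed K) {N : V → ℝ}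
    (hN : Continuous N) {A : V →L[ℝ] E} {f : E → ℝ} {y : E} {C r : ℝ} (hr : 0 < r)
    (hf : ∀ x ∈ Metric.ball y r, ∀ x' ∈ Metric.ball y r, |f x - f x'| ≤ C * ‖x - x'‖)
    (h : ∀ v ∈ K, ∀ ε > 0, ∀ᶠ t in 𝓝[>] (0 : ℝ), -N v - ε ≤ (f (y + t • A v) - f y) / t)
    {ε : ℝ} (hε : 0 < ε) :
    ∀ᶠ t in 𝓝[>] (0 : ℝ), ∀ v ∈ K ∩ Metric.closedBall 0 1,
      -N v - ε ≤ (f (y + t • A v) - f y) / t := by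
  have hcomp : IsCompact (K ∩ Metric.closedBall 0 1) := (isCompact_closedBall 0 1).inter_left hK
  rw [eventually_nhdsWithin_iff]
  have key := hcomp.eventually_forall_of_forall_eventually (x₀ := (0 : ℝ))
    (P := fun t v => t ∈ Ioi (0 : ℝ) → -N v - ε ≤ (f (y + t • A v) - f y) / t) ?_
  · filter_upwards [key] with t ht h0 v hv using ht v hv h0
  intro v hv
  have h1 := h v hv.1 (ε / 3) (by positivity)
  rw [eventually_nhdsWithin_iff] at h1
  have e1 : ∀ᶠ z : ℝ × V in 𝓝 (0, v), z.1 ∈ Ioi (0 : ℝ) →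
      -N v - ε / 3 ≤ (f (y + z.1 • A v) - f y) / z.1 := by
    rw [nhds_prod_eq]; exact h1.prod_inl _
  have e2 : ∀ᶠ z : ℝ × V in 𝓝 (0, v), N v - ε / 3 < N z.2 :=
    ((hN.comp continuous_snd).continuousAt.eventually (lt_mem_nhds (by simp; linarith)))
  have e3 : ∀ᶠ z : ℝ × V in 𝓝 (0, v), C * ‖A z.2 - A v‖ < ε / 3 := by
    have hc : Continuous fun z : ℝ × V => C * ‖A z.2 - A v‖ := by fun_prop
    exact hc.continuousAt.eventually (gt_mem_nhds (by simp; linarith))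
  have e4 : ∀ᶠ z : ℝ × V in 𝓝 (0, v), y + z.1 • A z.2 ∈ Metric.ball y r := by
    have hc : Continuous fun z : ℝ × V => y + z.1 • A z.2 := by fun_prop
    exact hc.continuousAt.eventually (Metric.isOpen_ball.mem_nhds (by simp [hr]))
  have e5 : ∀ᶠ z : ℝ × V in 𝓝 (0, v), y + z.1 • A v ∈ Metric.ball y r := by
    have hc : Continuous fun z : ℝ × V => y + z.1 • A v := by fun_prop
    exact hc.continuousAt.eventually (Metric.isOpen_ball.mem_nhds (by simp [hr]))
  filter_upwards [e1, e2, e3, e4, e5] with z z1 z2 z3 z4 z5 hz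
  have hz' : 0 < z.1 := hz
  have := z1 hz
  rw [le_div_iff₀ hz'] at this ⊢
  have hl := hf _ z5 _ z4
  have : ‖y + z.1 • A v - (y + z.1 • A z.2)‖ = z.1 * ‖A z.2 - A v‖ := by
    rw [add_sub_add_left_eq_sub, ← smul_sub, norm_smul, Real.norm_of_nonneg hz'.le, norm_sub_rev]
  rw [this] at hl
  have := (abs_le.1 hl).2
  nlinarith

theorem hasFDerivAt_mul_norm_sq {F : Type*} [NormedAddCommGroup F] [InnerProductSpace ℝ F]
    (T : E →L[ℝ] F) (a y x : E) (m s : ℝ) :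
    HasFDerivAt (fun x => m * ‖T (s • (x - y) - a)‖ ^ 2)
      ((2 * m * s) • (innerSL ℝ (T (s • (x - y) - a))).comp T) x := by
  have h0 : HasFDerivAt (fun x => s • (x - y) - a) (s • .id ℝ E) x :=
    (((hasFDerivAt_id (𝕜 := ℝ) x).sub_const y).const_smul s).sub_const a
  refine (((T.hasFDerivAt.comp x h0).norm_sq).const_mul m).congr_fderiv ?_
  ext w
  simp only [smul_apply, ContinuousLinearMap.comp_apply, innerSL_apply_apply, smul_eq_mul,
    nsmul_eq_mul, map_smul, ContinuousLinearMap.id_apply, Function.comp_apply]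
  push_cast
  ring

variable [FiniteDimensional ℝ E]

/-- The given norms need not be smooth, so penalties are squares of Euclidean norms; the constant
transfers bounds back. -/
theorem exists_pos_norm_le_mul_toEuclidean :
    ∃ τ > 0, ∀ x : E, ‖x‖ ≤ τ * ‖(toEuclidean : E ≃L[ℝ] _) x‖ := by
  let T : EuclideanSpace ℝ (Fin (Module.finrank ℝ E)) →L[ℝ] E := (toEuclidean : E ≃L[ℝ] _).symm
  refine ⟨‖T‖ + 1, by positivity, fun x => ?_⟩
  have h1 := T.le_opNorm ((toEuclidean : E ≃L[ℝ] _) x)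
  have h2 : T ((toEuclidean : E ≃L[ℝ] _) x) = x := (toEuclidean : E ≃L[ℝ] _).symm_apply_apply x
  rw [h2] at h1
  nlinarith [norm_nonneg ((toEuclidean : E ≃L[ℝ] _) x)]

/-- Penalised minimisation: if `v ↦ N v + D f (y; A v)` is nonnegative on the cone `K`, then `f` has
bounded smooth subgradients near `y` that are almost stationary along `K`. -/
theorem exists_almost_stationary_smoothSubgradient {K : Set V} (hK : IsClosed K)
    (h0 : (0 : V) ∈ K) (hadd : ∀ v ∈ K, ∀ w ∈ K, v + w ∈ K)
    (hsmul : ∀ s : ℝ, 0 ≤ s → ∀ v ∈ K, s • v ∈ K) {N : V → ℝ}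
    (hN : Continuous N) (hNadd : ∀ v w, N (v + w) ≤ N v + N w)
    (hNsmul : ∀ s : ℝ, 0 ≤ s → ∀ v, N (s • v) = s * N v)
    {A : V →L[ℝ] E} {f : E → ℝ} {y : E} {C r : ℝ} (hr : 0 < r) (hC : 0 ≤ C)
    (hf : ∀ x ∈ Metric.ball y r, ∀ x' ∈ Metric.ball y r, |f x - f x'| ≤ C * ‖x - x'‖)
    (h : ∀ v ∈ K, ∀ ε > 0, ∀ᶠ t in 𝓝[>] (0 : ℝ), -N v - ε ≤ (f (y + t • A v) - f y) / t) :
    ∃ B : ℝ, ∀ η > 0, ∃ (x : E) (ξ : E →L[ℝ] ℝ), ‖x - y‖ < η ∧ IsSmoothSubgradient f x ξ ∧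
      ‖ξ‖ ≤ B ∧ ∀ v ∈ K, -N v - η * ‖v‖ ≤ ξ (A v) := by
  let T : E →L[ℝ] EuclideanSpace ℝ (Fin (Module.finrank ℝ E)) := (toEuclidean : E ≃L[ℝ] _)
  let S : V →L[ℝ] EuclideanSpace ℝ (Fin (Module.finrank ℝ V)) := (toEuclidean : V ≃L[ℝ] _)
  obtain ⟨τ, hτ, hT⟩ : ∃ τ > 0, ∀ x : E, ‖x‖ ≤ τ * ‖T x‖ := exists_pos_norm_le_mul_toEuclidean
  obtain ⟨σ, hσ, hS⟩ : ∃ σ > 0, ∀ x : V, ‖x‖ ≤ σ * ‖S x‖ := exists_pos_norm_le_mul_toEuclidean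
  obtain ⟨c, hc⟩ : ∃ c, c = C * τ := ⟨_, rfl⟩
  have hc0 : 0 ≤ c := hc ▸ mul_nonneg hC hτ.le
  -- This bounds the penalty gradient, of norm at most 2 M d ‖T‖, uniformly in `η'`, because M d ≤ c
  -- + 1.
  refine ⟨2 * (c + 1) * ‖T‖, fun η' hη' => ?_⟩
  obtain ⟨η, hη, hηη⟩ : ∃ η > 0, 2 * η * ‖S‖ ^ 2 ≤ η' := by
    refine ⟨η' / (2 * ‖S‖ ^ 2 + 1), by positivity, ?_⟩
    rw [mul_div_assoc', div_mul_eq_mul_div, div_le_iff₀ (by positivity)]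
    nlinarith [norm_nonneg S]
  -- The first inequality will force ‖v‖ < 1, the second ‖z - A v‖ < 1, so that the minimiser avoids
  -- the boundary of both balls.
  obtain ⟨M, hM, hM1, hM2⟩ : ∃ M : ℝ, 0 < M ∧ σ ^ 2 * (c + 1) ^ 2 < M * η ∧ τ * (c + 1) < M := by
    refine ⟨σ ^ 2 * (c + 1) ^ 2 / η + τ * (c + 1) + 1, by positivity, ?_, ?_⟩
    · rw [add_mul, add_mul, div_mul_cancel₀ _ hη.ne']
      have : 0 < τ * (c + 1) * η := by positivity
      linarith
    · have : 0 < σ ^ 2 * (c + 1) ^ 2 / η := by positivity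
      linarith
  -- The ball of radius `R` contains a unit neighbourhood of every `A v` with ‖v‖ ≤ 1.
  obtain ⟨R, hR⟩ : ∃ R, R = ‖A‖ + 1 := ⟨_, rfl⟩
  have hR0 : 0 < R := by rw [hR]; positivity
  obtain ⟨t, ht, htl, htr, htη⟩ : ∃ t : ℝ, 0 < t ∧ (∀ v ∈ K ∩ Metric.closedBall 0 1,
      -N v - 1 / M ≤ (f (y + t • A v) - f y) / t) ∧ t * R < r ∧ t * R < η' := by
    have e1 := eventually_forall_quotient_ge hK hN hr hf h (ε := 1 / M) (by positivity)
    have e2 : ∀ᶠ t in 𝓝[>] (0 : ℝ), t * R < min r η' := by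
      refine nhdsWithin_le_nhds ?_
      have hcc : Continuous fun t : ℝ => t * R := by fun_prop
      exact hcc.continuousAt.eventually (gt_mem_nhds (by simp [hr, hη']))
    obtain ⟨t, ⟨h1, h2⟩, h3⟩ := ((e1.and e2).and self_mem_nhdsWithin).exists
    exact ⟨t, h3, h1, h2.trans_le (min_le_left _ _), h2.trans_le (min_le_right _ _)⟩
  have hball : ∀ z : E, ‖z‖ ≤ R → y + t • z ∈ Metric.ball y r := fun z hz => by
    rw [mem_ball_iff_norm, add_sub_cancel_left, norm_smul, Real.norm_of_nonneg ht.le]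
    exact (mul_le_mul_of_nonneg_left hz ht.le).trans_lt htr
  let φ : E → ℝ := fun z => (f (y + t • z) - f y) / t
  have hφ : ∀ z z' : E, ‖z‖ ≤ R → ‖z'‖ ≤ R → |φ z - φ z'| ≤ C * ‖z - z'‖ := fun z z' hz hz' => by
    have := hf _ (hball z hz) _ (hball z' hz')
    rw [add_sub_add_left_eq_sub, ← smul_sub, norm_smul, Real.norm_of_nonneg ht.le] at this
    have e : φ z - φ z' = (f (y + t • z) - f (y + t • z')) / t := by
      simp only [φ]; ring
    rw [e, abs_div, abs_of_pos ht, div_le_iff₀ ht]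
    linarith
  have hφc : ContinuousOn φ (Metric.closedBall 0 R) := by
    refine (LipschitzOnWith.of_dist_le_mul (K := ⟨C, hC⟩) fun z hz z' hz' => ?_).continuousOn
    rw [Real.dist_eq, dist_eq_norm]
    exact hφ z z' (by simpa using hz) (by simpa using hz')
  -- The variable `z` replaces `A v` and is tied to it only by the penalty; the last term keeps the
  -- minimising `v` inside the unit ball.
  let Ψ : V × E → ℝ := fun x => φ x.2 + N x.1 + M * ‖T (x.2 - A x.1)‖ ^ 2 + η * ‖S x.1‖ ^ 2
  have hΨc : ContinuousOn Ψ ((K ∩ Metric.closedBall 0 1) ×ˢ Metric.closedBall 0 R) := by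
    have h1 : ContinuousOn (fun x : V × E => φ x.2)
        ((K ∩ Metric.closedBall 0 1) ×ˢ Metric.closedBall 0 R) :=
      hφc.comp continuous_snd.continuousOn fun x hx => hx.2
    refine ContinuousOn.add (ContinuousOn.add (h1.add (Continuous.continuousOn ?_))
      (Continuous.continuousOn ?_)) (Continuous.continuousOn ?_) <;> fun_prop
  have hcomp : IsCompact ((K ∩ Metric.closedBall 0 1) ×ˢ Metric.closedBall (0 : E) R) :=
    ((isCompact_closedBall (0 : V) 1).inter_left hK).prod (isCompact_closedBall 0 R)
  have hmem0 : ((0, 0) : V × E) ∈ (K ∩ Metric.closedBall 0 1) ×ˢ Metric.closedBall (0 : E) R :=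
    ⟨⟨h0, by simp⟩, by simp [hR0.le]⟩
  obtain ⟨⟨v, z⟩, ⟨⟨hvK, hv1⟩, hzR⟩, hmin⟩ := hcomp.exists_isMinOn ⟨_, hmem0⟩ hΨc
  simp only [Metric.mem_closedBall, dist_zero_right] at hv1 hzR
  have hN0 : N 0 = 0 := by simpa using hNsmul 0 le_rfl 0
  have hΨ0 : Ψ (v, z) ≤ 0 := (hmin hmem0).trans_eq (by simp [Ψ, φ, hN0])
  have hAv : ‖A v‖ ≤ ‖A‖ := by
    simpa using (A.le_opNorm v).trans (mul_le_mul_of_nonneg_left hv1 (norm_nonneg A))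
  obtain ⟨d, hd⟩ : ∃ d, d = ‖T (z - A v)‖ := ⟨_, rfl⟩
  have hd0 : 0 ≤ d := hd ▸ norm_nonneg _
  have hzA : ‖z - A v‖ ≤ τ * d := hd ▸ hT _
  -- Compare the minimum, at most Ψ(0, 0) = 0, with φ(A v) + N v ≥ -1/M and the Lipschitz bound for
  -- φ(z) - φ(A v).
  have hcoer : M * d ^ 2 + η * ‖S v‖ ^ 2 ≤ 1 / M + c * d := by
    have h1 := htl v ⟨hvK, by simpa using hv1⟩
    have h2 := (abs_le.1 (hφ z (A v) hzR (hAv.trans (by rw [hR]; linarith)))).1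
    have h3 : C * ‖z - A v‖ ≤ c * d := by
      rw [hc, mul_assoc]; exact mul_le_mul_of_nonneg_left hzA hC
    have h4 : Ψ (v, z) = φ z + N v + M * d ^ 2 + η * ‖S v‖ ^ 2 := by simp only [Ψ, hd]
    have h5 : -N v - 1 / M ≤ φ (A v) := h1
    linarith
  obtain ⟨hMd, hMS⟩ := penalty_estimates hM hη.le hc0 hd0 hcoer
  have hv1' : ‖v‖ < 1 := by
    have h2 : M * η * ‖v‖ ^ 2 ≤ M * η * (σ * ‖S v‖) ^ 2 := by
      gcongr; exact hS v
    have h3 : M * η * (σ * ‖S v‖) ^ 2 ≤ σ ^ 2 * (c + 1) ^ 2 := by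
      have := mul_le_mul_of_nonneg_left hMS (sq_nonneg σ)
      linarith
    have h4 : 0 < M * η := by positivity
    have h5 : ‖v‖ ^ 2 < 1 := by
      refine lt_of_mul_lt_mul_left ?_ h4.le
      linarith
    exact (sq_lt_one_iff₀ (norm_nonneg v)).1 h5
  have hzR' : ‖z‖ < R := by
    have h1 : ‖z‖ ≤ ‖z - A v‖ + ‖A v‖ := by simpa using norm_add_le (z - A v) (A v)
    have h2 : τ * d < 1 := by
      have : M * (τ * d) ≤ τ * (c + 1) := by
        have := mul_le_mul_of_nonneg_left hMd hτ.le
        linarith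
      refine lt_of_mul_lt_mul_left ?_ hM.le
      linarith
    rw [hR]; linarith
  -- For fixed `v`, minimality in `z` says that `φ` minus the negative penalty has a local minimum
  -- at `z`. Undoing the scaling by `t` gives the touching function for `f`, with this derivative.
  let ξ : E →L[ℝ] ℝ := -(2 * M) • (innerSL ℝ (T (z - A v))).comp T
  have hξ : ∀ w, ξ w = -(2 * M) * inner ℝ (T (z - A v)) (T w) := fun w => rfl
  refine ⟨y + t • z, ξ, ?_, ⟨fun x => -(t * M) * ‖T (t⁻¹ • (x - y) - A v)‖ ^ 2, ?_, ?_, ?_⟩, ?_, ?_⟩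
  · rw [add_sub_cancel_left, norm_smul, Real.norm_of_nonneg ht.le]
    exact (mul_le_mul_of_nonneg_left hzR ht.le).trans_lt htη
  · refine contDiff_const.mul (ContDiff.norm_sq ℝ (T.contDiff.comp ?_))
    exact (contDiff_const.smul (contDiff_id.sub contDiff_const)).sub contDiff_const
  · refine (hasFDerivAt_mul_norm_sq T (A v) y (y + t • z) (-(t * M)) t⁻¹).fderiv.trans ?_
    rw [add_sub_cancel_left, smul_smul, inv_mul_cancel₀ ht.ne', one_smul]
    simp only [ξ]
    congr 1
    field_simp
  · have hcont : Tendsto (fun x => t⁻¹ • (x - y)) (𝓝 (y + t • z)) (𝓝 z) := by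
      have hcc : Continuous fun x => t⁻¹ • (x - y) := by fun_prop
      have := hcc.tendsto (y + t • z)
      rwa [add_sub_cancel_left, smul_smul, inv_mul_cancel₀ ht.ne', one_smul] at this
    have hopen : Metric.ball (0 : E) R ∈ 𝓝 z := Metric.isOpen_ball.mem_nhds (by simpa using hzR')
    filter_upwards [hcont.eventually hopen] with x hx
    have hx' : ((v, t⁻¹ • (x - y)) : V × E) ∈
        (K ∩ Metric.closedBall 0 1) ×ˢ Metric.closedBall (0 : E) R :=
      ⟨⟨hvK, by simpa using hv1⟩, Metric.ball_subset_closedBall hx⟩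
    have h1 : Ψ (v, z) ≤ Ψ (v, t⁻¹ • (x - y)) := hmin hx'
    have h2 : t⁻¹ • (y + t • z - y) = z := by
      rw [add_sub_cancel_left, smul_smul, inv_mul_cancel₀ ht.ne', one_smul]
    have h3 : y + t • t⁻¹ • (x - y) = x := by
      rw [smul_smul, mul_inv_cancel₀ ht.ne', one_smul, add_sub_cancel]
    simp only [Ψ, φ, h3] at h1
    simp only [h2]
    have h4 := mul_le_mul_of_nonneg_left h1 ht.le
    have h5 : ∀ a b e k : ℝ, t * ((a - f y) / t + b + M * e + k) =
        a - f y + t * b + t * M * e + t * k := fun a b e k => by field_simp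
    rw [h5, h5] at h4
    linarith
  · have h1 : ‖(innerSL ℝ (T (z - A v))).comp T‖ ≤ d * ‖T‖ := by
      refine (ContinuousLinearMap.opNorm_comp_le _ _).trans_eq ?_
      rw [innerSL_apply_norm, hd]
    calc ‖ξ‖ = 2 * M * ‖(innerSL ℝ (T (z - A v))).comp T‖ := by
          rw [norm_smul, norm_neg, Real.norm_of_nonneg (by positivity)]
      _ ≤ 2 * M * (d * ‖T‖) := by gcongr
      _ = 2 * (M * d) * ‖T‖ := by ring
      _ ≤ 2 * (c + 1) * ‖T‖ := by gcongr
  · intro w hw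
    -- Minimality in `v`: as `K` is a convex cone and ‖v‖ < 1, the point v + s w is admissible for
    -- small s > 0. Sublinearity of `N` leaves a linear term plus a quadratic one in s.
    have key : 0 ≤ N w + ξ (A w) + 2 * η * inner ℝ (S v) (S w) := by
      refine nonneg_of_mul_add_sq_nonneg (b := M * ‖T (A w)‖ ^ 2 + η * ‖S w‖ ^ 2)
        (r := (1 - ‖v‖) / (‖w‖ + 1)) (div_pos (by linarith) (by positivity)) fun s hs hsr => ?_
      have hsw : ‖v + s • w‖ ≤ 1 := by
        rw [lt_div_iff₀ (by positivity)] at hsr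
        refine (norm_add_le _ _).trans ?_
        rw [norm_smul, Real.norm_of_nonneg hs.le]
        nlinarith
      have hmem : ((v + s • w, z) : V × E) ∈
          (K ∩ Metric.closedBall 0 1) ×ˢ Metric.closedBall (0 : E) R :=
        ⟨⟨hadd _ hvK _ (hsmul s hs.le w hw), by simpa using hsw⟩, by simpa using hzR⟩
      have h1 : Ψ (v, z) ≤ Ψ (v + s • w, z) := hmin hmem
      have h2 : N (v + s • w) ≤ N v + s * N w := (hNadd _ _).trans_eq (by rw [hNsmul s hs.le])
      have h3 : T (z - A (v + s • w)) = T (z - A v) - s • T (A w) := by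
        simp only [map_add, map_sub, map_smul]; abel
      have h4 : S (v + s • w) = S v + s • S w := by simp
      simp only [Ψ, h3, h4, norm_sub_sq_real, norm_add_sq_real, inner_smul_right, norm_smul,
        Real.norm_of_nonneg hs.le] at h1
      rw [hξ]
      linarith
    have h1 : inner ℝ (S v) (S w) ≤ ‖S‖ ^ 2 * ‖w‖ := by
      refine (real_inner_le_norm _ _).trans ?_
      have h2 : ‖S v‖ ≤ ‖S‖ := by
        simpa using (S.le_opNorm v).trans (mul_le_mul_of_nonneg_left hv1 (norm_nonneg S))
      calc ‖S v‖ * ‖S w‖ ≤ ‖S‖ * (‖S‖ * ‖w‖) := by gcongr; exact S.le_opNorm w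
        _ = ‖S‖ ^ 2 * ‖w‖ := by ring
    have h2 : 2 * η * inner ℝ (S v) (S w) ≤ η' * ‖w‖ := by
      calc 2 * η * inner ℝ (S v) (S w) ≤ 2 * η * (‖S‖ ^ 2 * ‖w‖) := by gcongr
        _ = (2 * η * ‖S‖ ^ 2) * ‖w‖ := by ring
        _ ≤ η' * ‖w‖ := by gcongr
    linarith

/-- If `v ↦ N v + D f (y; A v)` is nonnegative on the closed convex cone `K`, some limiting
subgradient `p` of `f` at `y` satisfies `-N v ≤ p (A v)` on `K`. -/
theorem exists_stationary_limitingSubgradient {K : Set V} (hK : IsClosed K)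
    (h0 : (0 : V) ∈ K) (hadd : ∀ v ∈ K, ∀ w ∈ K, v + w ∈ K)
    (hsmul : ∀ s : ℝ, 0 ≤ s → ∀ v ∈ K, s • v ∈ K) {N : V → ℝ}
    (hN : Continuous N) (hNadd : ∀ v w, N (v + w) ≤ N v + N w)
    (hNsmul : ∀ s : ℝ, 0 ≤ s → ∀ v, N (s • v) = s * N v)
    {A : V →L[ℝ] E} {f : E → ℝ} {y : E} {C r : ℝ} (hr : 0 < r) (hC : 0 ≤ C)
    (hf : ∀ x ∈ Metric.ball y r, ∀ x' ∈ Metric.ball y r, |f x - f x'| ≤ C * ‖x - x'‖)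
    (h : ∀ v ∈ K, ∀ ε > 0, ∀ᶠ t in 𝓝[>] (0 : ℝ), -N v - ε ≤ (f (y + t • A v) - f y) / t) :
    ∃ p, IsLimitingSubgradient f y p ∧ ∀ v ∈ K, -N v ≤ p (A v) := by
  obtain ⟨B, hB⟩ := exists_almost_stationary_smoothSubgradient hK h0 hadd hsmul hN hNadd hNsmul
    hr hC hf h
  choose x ξ hx hξ hξB hst using fun k : ℕ => hB (1 / (k + 1)) (by positivity)
  have hxt : Tendsto x atTop (𝓝 y) := by
    rw [tendsto_iff_norm_sub_tendsto_zero]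
    exact squeeze_zero (fun _ => norm_nonneg _) (fun k => (hx k).le)
      tendsto_one_div_add_atTop_nhds_zero_nat
  -- The bound `B` is independent of k, so finite dimension gives a convergent subsequence.
  obtain ⟨p, -, θ, hθ, hp⟩ := (isCompact_closedBall (0 : E →L[ℝ] ℝ) B).tendsto_subseq
    (x := ξ) fun k => by simpa using hξB k
  refine ⟨p, ⟨x ∘ θ, ξ ∘ θ, fun k => hξ _, hxt.comp hθ.tendsto_atTop, hp⟩, fun v hv => ?_⟩
  have h1 : Tendsto (fun k => ξ (θ k) (A v)) atTop (𝓝 (p (A v))) :=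
    ((ContinuousLinearMap.apply ℝ ℝ (A v)).continuous.tendsto p).comp hp
  have h2 : Tendsto (fun k => -N v - 1 / ((θ k : ℝ) + 1) * ‖v‖) atTop (𝓝 (-N v - 0 * ‖v‖)) :=
    tendsto_const_nhds.sub
      ((tendsto_one_div_add_atTop_nhds_zero_nat.comp hθ.tendsto_atTop).mul_const _)
  rw [zero_mul, sub_zero] at h2
  exact le_of_tendsto_of_tendsto' h2 h1 fun k => hst _ v hv

end Decoupling

/-! ### Transfer of limiting subgradients from a chart to the cotangent bundle. -/

section Cotangent

variable {E : Type*} [NormedAddCommGroup E] [NormedSpace ℝ E] {H : Type*} [TopologicalSpace H]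
  {I : ModelWithCorners ℝ E H} {M : Type*} [TopologicalSpace M] [ChartedSpace H M]

/-- A covector, as a functional on the model space. -/
def Cotangent.toModel {q : M} (p : Cotangent I q) : E →L[ℝ] ℝ := p

theorem hasMFDerivAt_iff_hasFDerivAt [I.Boundaryless] {E' : Type*} [NormedAddCommGroup E']
    [NormedSpace ℝ E'] {H' : Type*} [TopologicalSpace H'] {I' : ModelWithCorners ℝ E' H'}
    {M' : Type*} [TopologicalSpace M'] [ChartedSpace H' M'] {f : M → M'} {x : M}
    {f' : E →L[ℝ] E'} :
    HasMFDerivAt I I' f x f' ↔ ContinuousAt f x ∧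
      HasFDerivAt (writtenInExtChartAt I I' x f) f' (extChartAt I x x) := by
  rw [← hasFDerivWithinAt_univ, ← I.range_eq_univ]
  rfl

/-- Convergence in the cotangent bundle, in coordinates around the limit point. -/
theorem tendsto_cotangent_iff [IsManifold I 1 M] {α : Type*} {l : Filter α} {q : M}
    {p : Cotangent I q} {x : α → M} {P : ∀ k, Cotangent I (x k)} :
    Tendsto (fun k => (⟨x k, P k⟩ : TotalSpace (E →L[ℝ] ℝ) (fun y : M => Cotangent I y))) l
      (𝓝 ⟨q, p⟩) ↔ Tendsto x l (𝓝 q) ∧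
        Tendsto (fun k => (P k).toModel.comp (tangentCoordChange I q (x k) (x k))) l
          (𝓝 p.toModel) := by
  have hcoord : ∀ (y : M) (ξ : Cotangent I y), y ∈ (chartAt H q).source →
      (trivializationAt (E →L[ℝ] ℝ) (fun y : M => Cotangent I y) q ⟨y, ξ⟩).2 =
        ξ.toModel.comp (tangentCoordChange I q y y) := by
    intro y ξ hy
    rw [hom_trivializationAt_apply]
    simp only [ContinuousLinearMap.inCoordinates]
    ext v
    simp only [ContinuousLinearMap.comp_apply]
    erw [Trivial.continuousLinearMapAt_trivialization]
    rw [TangentBundle.symmL_trivializationAt_eq_core hy]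
    rfl
  rw [(trivializationAt (E →L[ℝ] ℝ) (fun y : M => Cotangent I y) q).tendsto_nhds_iff
    (FiberBundle.mem_trivializationAt_proj_source (F := E →L[ℝ] ℝ)
      (E := fun y : M => Cotangent I y) (x := ⟨q, p⟩))]
  refine and_congr_right fun hx => ?_
  have hx' : Tendsto x l (𝓝 q) := hx
  rw [hcoord q p (mem_chart_source H q)]
  have hself : p.toModel.comp (tangentCoordChange I q q q) = p.toModel := by
    ext v
    exact congrArg p.toModel (tangentCoordChange_self (mem_extChartAt_source q))
  rw [hself]
  refine tendsto_congr' ?_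
  filter_upwards [hx'.eventually ((chartAt H q).open_source.mem_nhds (mem_chart_source H q))]
    with k hk using hcoord _ _ hk

/-- The coordinates around `q` of the differential of `G` at `x` form the derivative of `G` read in
the chart at `q`. -/
theorem hasFDerivAt_comp_tangentCoordChange [IsManifold I 1 M] [I.Boundaryless] {G : M → ℝ}
    {q x : M} {P : Cotangent I x} (hG : HasMFDerivAt I 𝓘(ℝ, ℝ) G x P)
    (hx : x ∈ (chartAt H q).source) :
    HasFDerivAt (G ∘ (extChartAt I q).symm)
      (P.toModel.comp (tangentCoordChange I q x x)) (extChartAt I q x) := by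
  have hxq : x ∈ (extChartAt I q).source := by rwa [extChartAt_source]
  have h1 := hasFDerivWithinAt_tangentCoordChange (I := I) (x := q) (y := x) (z := x)
    ⟨hxq, mem_extChartAt_source x⟩
  have h2 := (hasMFDerivAt_iff_hasFDerivAt (f' := P.toModel).1 hG).2
  rw [I.range_eq_univ, hasFDerivWithinAt_univ] at h1
  have hpt : ((extChartAt I x) ∘ (extChartAt I q).symm) (extChartAt I q x) = extChartAt I x x := by
    rw [Function.comp_apply, (extChartAt I q).left_inv hxq]
  rw [← hpt] at h2
  refine (h2.comp _ h1).congr_of_eventuallyEq ?_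
  have hcont : ContinuousAt (extChartAt I q).symm (extChartAt I q x) :=
    continuousAt_extChartAt_symm' hxq
  have hs : (extChartAt I x).source ∈ 𝓝 ((extChartAt I q).symm (extChartAt I q x)) := by
    rw [(extChartAt I q).left_inv hxq]; exact extChartAt_source_mem_nhds x
  filter_upwards [hcont.eventually hs] with z hz
  simp only [writtenInExtChartAt, Function.comp_apply, extChartAt_model_space_eq_id,
    PartialEquiv.refl_coe, id]
  rw [(extChartAt I x).left_inv hz]

variable [FiniteDimensional ℝ E] [T2Space M] [IsManifold I ∞ M]

/-- Fréchet subgradients require test functions defined on all of `M`; a bump function extends those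
given in a chart. The neighbourhood does not depend on `g`, so it serves a whole sequence of test
functions. -/
theorem exists_nhds_forall_exists_contMDiff_eqOn (q : M) :
    ∃ s ∈ 𝓝 q, IsOpen s ∧ ∀ g : E → ℝ, ContDiff ℝ ∞ g →
      ∃ G : M → ℝ, ContMDiff I 𝓘(ℝ, ℝ) ∞ G ∧ EqOn G (g ∘ extChartAt I q) s := by
  obtain ⟨b⟩ : Nonempty (SmoothBumpFunction I q) := inferInstance
  obtain ⟨s, hs, hso, hqs⟩ := _root_.mem_nhds_iff.1 b.eventuallyEq_one
  refine ⟨s, hso.mem_nhds hqs, hso, fun g hg => ⟨fun x => b x • (g ∘ extChartAt I q) x,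
    b.contMDiff_smul (hg.contMDiff.comp_contMDiffOn contMDiffOn_extChartAt), fun x hx => ?_⟩⟩
  have : b x = 1 := hs hx
  simp [this]

variable [I.Boundaryless]

/-- A limiting subgradient of `f` read in the chart at `q` is a limiting subgradient of `f`. -/
theorem mem_limitingSubdiffReal_of_isLimitingSubgradient {f : M → ℝ} {q : M}
    (hf : ContinuousAt f q) {p : Cotangent I q}
    (h : IsLimitingSubgradient (f ∘ (extChartAt I q).symm) (extChartAt I q q) p.toModel) :
    p ∈ limitingSubdiffReal I f q := by
  obtain ⟨z, ξ, hξ, hz, hp⟩ := h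
  choose g hg hgd hmin using hξ
  obtain ⟨s, hs, hso, hG⟩ := exists_nhds_forall_exists_contMDiff_eqOn (I := I) q
  choose G hG hGq using fun k => hG (g k) (hg k)
  let x : ℕ → M := fun k => (extChartAt I q).symm (z k)
  have hx : Tendsto x atTop (𝓝 q) := by
    have := (continuousAt_extChartAt_symm (I := I) q).tendsto.comp hz
    rwa [extChartAt_to_inv] at this
  have hev : ∀ᶠ k in atTop, z k ∈ (extChartAt I q).target ∧ x k ∈ s :=
    (hz.eventually (extChartAt_target_mem_nhds q)).and (hx.eventually hs)
  -- Every member of the sequence must carry a Fréchet subgradient, so the indices whose points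
  -- leave the chart or `s` are dropped by a shift.
  obtain ⟨k₀, hk₀⟩ := eventually_atTop.1 hev
  have hxs : ∀ k, k₀ ≤ k → x k ∈ (extChartAt I q).source :=
    fun k hk => (extChartAt I q).map_target (hk₀ k hk).1
  have hxz : ∀ k, k₀ ≤ k → extChartAt I q (x k) = z k :=
    fun k hk => (extChartAt I q).right_inv (hk₀ k hk).1
  have hshift : Tendsto (fun k => k + k₀) atTop atTop := tendsto_add_atTop_nat k₀
  refine ⟨fun k => x (k + k₀), fun k => mfderiv I 𝓘(ℝ, ℝ) (G (k + k₀)) (x (k + k₀)),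
    fun k => ⟨G (k + k₀), (hG _).of_le (by exact_mod_cast le_top), rfl, ?_⟩, ?_, ?_⟩
  · have hk : k₀ ≤ k + k₀ := Nat.le_add_left _ _
    have hcont : Tendsto (extChartAt I q) (𝓝 (x (k + k₀))) (𝓝 (z (k + k₀))) := by
      rw [← hxz _ hk]; exact continuousAt_extChartAt' (hxs _ hk)
    have hsrc : (extChartAt I q).source ∈ 𝓝 (x (k + k₀)) :=
      extChartAt_source_mem_nhds' (hxs _ hk)
    filter_upwards [hcont.eventually (hmin (k + k₀)), hsrc, hso.mem_nhds (hk₀ _ hk).2]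
      with w hw hwsrc hws
    simp only [Function.comp_apply, (extChartAt I q).left_inv hwsrc] at hw
    have e1 : G (k + k₀) w = g (k + k₀) (extChartAt I q w) := hGq _ hws
    have e2 : G (k + k₀) (x (k + k₀)) = g (k + k₀) (z (k + k₀)) := by
      rw [← hxz _ hk]; exact hGq _ (hk₀ _ hk).2
    rw [← EReal.coe_sub, ← EReal.coe_sub, EReal.coe_le_coe_iff, e1, e2]
    exact hw
  · exact (continuous_coe_real_ereal.continuousAt.tendsto.comp hf.tendsto).comp (hx.comp hshift)
  · refine tendsto_cotangent_iff.2 ⟨hx.comp hshift, (hp.comp hshift).congr fun k => ?_⟩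
    have hk : k₀ ≤ k + k₀ := Nat.le_add_left _ _
    have h1 := hasFDerivAt_comp_tangentCoordChange (q := q)
      (((hG (k + k₀)).mdifferentiable (by simp)) (x (k + k₀))).hasMFDerivAt
      (by rw [← extChartAt_source I]; exact hxs _ hk)
    rw [hxz _ hk] at h1
    refine UniqueDiffWithinAt.eq uniqueDiffWithinAt_univ (HasFDerivAt.hasFDerivWithinAt ?_)
      h1.hasFDerivWithinAt
    have h2 : HasFDerivAt (g (k + k₀)) (ξ (k + k₀)) (z (k + k₀)) := by
      rw [← hgd]; exact ((hg _).differentiable (by simp) _).hasFDerivAt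
    refine h2.congr_of_eventuallyEq ?_
    have hcont : ContinuousAt (extChartAt I q).symm (z (k + k₀)) :=
      continuousAt_extChartAt_symm'' (hk₀ _ hk).1
    filter_upwards [hcont.eventually (hso.mem_nhds (hk₀ _ hk).2),
      extChartAt_target_mem_nhds' (hk₀ _ hk).1] with w hw hwt
    have := hGq (k + k₀) hw
    rwa [Function.comp_apply, (extChartAt I q).right_inv hwt] at this

end Cotangent

/-! ### Derivatives with prescribed base and image points. -/

section DerivativeTo

variable {E : Type*} [NormedAddCommGroup E] [NormedSpace ℝ E] {H : Type*} [TopologicalSpace H]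
  {I : ModelWithCorners ℝ E H} {M : Type*} [TopologicalSpace M] [ChartedSpace H M]
  {E' : Type*} [NormedAddCommGroup E'] [NormedSpace ℝ E'] {H' : Type*} [TopologicalSpace H']
  {I' : ModelWithCorners ℝ E' H'} {M' : Type*} [TopologicalSpace M'] [ChartedSpace H' M']
  {E'' : Type*} [NormedAddCommGroup E''] [NormedSpace ℝ E''] {H'' : Type*} [TopologicalSpace H'']
  {I'' : ModelWithCorners ℝ E'' H''} {M'' : Type*} [TopologicalSpace M''] [ChartedSpace H'' M'']

variable (I I') in
/-- `f` maps `x` to `y` with derivative `f'`, read in the preferred charts at `x` and `y`. This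
avoids casts between tangent spaces at propositionally equal points. -/
structure HasMFDerivTo (f : M → M') (x : M) (y : M') (f' : E →L[ℝ] E') : Prop where
  map_eq : f x = y
  continuousAt : ContinuousAt f x
  hasFDerivAt : HasFDerivAt (extChartAt I' y ∘ f ∘ (extChartAt I x).symm) f' (extChartAt I x x)

theorem HasMFDerivTo.unique {f : M → M'} {x : M} {y : M'} {f' f₁' : E →L[ℝ] E'}
    (h : HasMFDerivTo I I' f x y f') (h₁ : HasMFDerivTo I I' f x y f₁') : f' = f₁' :=
  h.hasFDerivAt.unique h₁.hasFDerivAt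

theorem HasMFDerivTo.prodMk {f : M → M'} {g : M → M''} {x : M} {y : M'} {z : M''}
    {f' : E →L[ℝ] E'} {g' : E →L[ℝ] E''} (hf : HasMFDerivTo I I' f x y f')
    (hg : HasMFDerivTo I I'' g x z g') :
    HasMFDerivTo I (I'.prod I'') (fun t => (f t, g t)) x (y, z) (f'.prod g') :=
  ⟨by rw [hf.map_eq, hg.map_eq], hf.continuousAt.prodMk hg.continuousAt, by
    rw [extChartAt_prod]
    exact hf.hasFDerivAt.prodMk hg.hasFDerivAt⟩

theorem hasMFDerivTo_const (x : M) (y : M') : HasMFDerivTo I I' (fun _ => y) x y 0 :=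
  ⟨rfl, continuousAt_const, hasFDerivAt_const (extChartAt I' y y) _⟩

variable [I.Boundaryless]

theorem hasMFDerivTo_self_iff {f : M → M'} {x : M} {f' : E →L[ℝ] E'} :
    HasMFDerivTo I I' f x (f x) f' ↔ HasMFDerivAt I I' f x f' := by
  rw [hasMFDerivAt_iff_hasFDerivAt]
  exact ⟨fun h => ⟨h.2, h.3⟩, fun h => ⟨rfl, h.1, h.2⟩⟩

theorem HasMFDerivTo.comp [I'.Boundaryless] {g : M' → M''} {f : M → M'} {x : M} {y : M'} {z : M''}
    {g' : E' →L[ℝ] E''} {f' : E →L[ℝ] E'} (hg : HasMFDerivTo I' I'' g y z g')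
    (hf : HasMFDerivTo I I' f x y f') : HasMFDerivTo I I'' (g ∘ f) x z (g'.comp f') := by
  obtain rfl := hf.map_eq
  obtain rfl := hg.map_eq
  exact hasMFDerivTo_self_iff.2
    (HasMFDerivAt.comp x (hasMFDerivTo_self_iff.1 hg) (hasMFDerivTo_self_iff.1 hf))

theorem hasMFDerivTo_id (x : M) : HasMFDerivTo I I id x x (.id ℝ E) :=
  hasMFDerivTo_self_iff.2 (hasMFDerivAt_id x)

end DerivativeTo

/-! ### Calculus on finite products of manifolds. -/

section Pi

variable {ι : Type*} [Fintype ι] {E : ι → Type*} [∀ i, NormedAddCommGroup (E i)]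
  [∀ i, NormedSpace ℝ (E i)] {H : ι → Type*} [∀ i, TopologicalSpace (H i)]
  {I : ∀ i, ModelWithCorners ℝ (E i) (H i)}
  {M : ι → Type*} [∀ i, TopologicalSpace (M i)] [∀ i, ChartedSpace (H i) (M i)]
  {E' : Type*} [NormedAddCommGroup E'] [NormedSpace ℝ E'] {H' : Type*} [TopologicalSpace H']
  {I' : ModelWithCorners ℝ E' H'} {N : Type*} [TopologicalSpace N] [ChartedSpace H' N]

theorem boundaryless_pi [∀ i, (I i).Boundaryless] : (ModelWithCorners.pi I).Boundaryless where
  range_eq_univ := by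
    rw [eq_univ_iff_forall]
    intro x
    choose y hy using fun i => (show x i ∈ range (I i) by simp [(I i).range_eq_univ])
    exact ⟨y, funext hy⟩

theorem extChartAt_pi_source (u : ∀ i, M i) :
    (extChartAt (ModelWithCorners.pi I) u).source =
      univ.pi fun i => (extChartAt (I i) (u i)).source := by
  ext x
  simp [piChartedSpace_chartAt]

theorem HasMFDerivTo.pi {f : ∀ i, N → M i} {x : N} {y : ∀ i, M i} {f' : ∀ i, E' →L[ℝ] E i}
    (h : ∀ i, HasMFDerivTo I' (I i) (f i) x (y i) (f' i)) :
    HasMFDerivTo I' (ModelWithCorners.pi I) (fun t i => f i t) x y (ContinuousLinearMap.pi f') :=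
  ⟨funext fun i => (h i).map_eq, continuousAt_pi.2 fun i => (h i).continuousAt,
    hasFDerivAt_pi.2 fun i => (h i).hasFDerivAt⟩

theorem contMDiff_pi {k : ℕ∞ω} {f : N → ∀ i, M i}
    (h : ∀ i, ContMDiff I' (I i) k fun t => f t i) :
    ContMDiff I' (ModelWithCorners.pi I) k f := by
  intro x
  rw [contMDiffAt_iff]
  refine ⟨continuousAt_pi.2 fun i => (h i x).continuousAt, contDiffWithinAt_pi.2 fun i => ?_⟩
  exact (contMDiffAt_iff.1 (h i x)).2

variable [DecidableEq ι]

theorem hasMFDerivTo_update [∀ i, (I i).Boundaryless] (x : ∀ i, M i) (i : ι) :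
    HasMFDerivTo (I i) (ModelWithCorners.pi I) (Function.update x i) (x i) x
      (ContinuousLinearMap.single ℝ E i) := by
  have : ∀ j, HasMFDerivTo (I i) (I j) (fun t => Function.update x i t j) (x i) (x j)
      ((ContinuousLinearMap.proj j).comp (ContinuousLinearMap.single ℝ E i)) := by
    intro j
    rcases eq_or_ne j i with rfl | hj
    · convert hasMFDerivTo_id (I := I j) (x j) using 1
      · ext; simp
      · ext; simp
    · convert hasMFDerivTo_const (I := I i) (I' := I j) (x i) (x j) using 1
      · ext; simp [hj]
      · ext; simp [hj]
  exact HasMFDerivTo.pi this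

theorem contMDiff_update {k : ℕ∞ω} (x : ∀ i, M i) (i : ι) :
    ContMDiff (I i) (ModelWithCorners.pi I) k (Function.update x i) := by
  refine contMDiff_pi fun j => ?_
  rcases eq_or_ne j i with rfl | hj
  · simpa using! contMDiff_id
  · simpa [hj] using contMDiff_const

/-- Transition maps of product charts act factor by factor, so their derivatives are block diagonal.
Restricting covectors to a factor therefore respects convergence in the cotangent bundle. -/
theorem tangentCoordChange_pi_single [∀ i, IsManifold (I i) ∞ (M i)] [∀ i, (I i).Boundaryless]
    {x y z : ∀ i, M i}
    (hx : ∀ i, z i ∈ (extChartAt (I i) (x i)).source)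
    (hy : ∀ i, z i ∈ (extChartAt (I i) (y i)).source) (i : ι) (w : E i) :
    tangentCoordChange (ModelWithCorners.pi I) x y z (Pi.single i w) =
      Pi.single i (tangentCoordChange (I i) (x i) (y i) (z i) w) := by
  have := boundaryless_pi (I := I)
  have h1 := hasFDerivWithinAt_tangentCoordChange (I := ModelWithCorners.pi I) (x := x) (y := y)
    (z := z) (by simp only [extChartAt_pi_source]; exact ⟨fun i _ => hx i, fun i _ => hy i⟩)
  have h2 : ∀ i, HasFDerivAt ((extChartAt (I i) (y i)) ∘ (extChartAt (I i) (x i)).symm)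
      (tangentCoordChange (I i) (x i) (y i) (z i)) (extChartAt (I i) (x i) (z i)) := fun i => by
    have := hasFDerivWithinAt_tangentCoordChange (I := I i) ⟨hx i, hy i⟩
    rwa [(I i).range_eq_univ, hasFDerivWithinAt_univ] at this
  rw [ModelWithCorners.range_eq_univ, hasFDerivWithinAt_univ] at h1
  have h3 : HasFDerivAt ((extChartAt (ModelWithCorners.pi I) y) ∘
      (extChartAt (ModelWithCorners.pi I) x).symm) (ContinuousLinearMap.pi fun i =>
        (tangentCoordChange (I i) (x i) (y i) (z i)).comp (ContinuousLinearMap.proj i))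
      (extChartAt (ModelWithCorners.pi I) x z) := by
    refine hasFDerivAt_pi.2 fun i => ?_
    exact HasFDerivAt.comp (g := (extChartAt (I i) (y i)) ∘ (extChartAt (I i) (x i)).symm) _ (h2 i)
      (hasFDerivAt_apply i _)
  rw [h1.unique h3]
  ext j
  rcases eq_or_ne j i with rfl | hj
  · simp
  · simp [hj]

end Pi

/-! ### Normal and tangent cones of product sets. -/

section ClarkeProduct

variable {ι : Type*} [Fintype ι] [DecidableEq ι] {E : ι → Type*} [∀ i, NormedAddCommGroup (E i)]
  [∀ i, NormedSpace ℝ (E i)] {H : ι → Type*} [∀ i, TopologicalSpace (H i)]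
  {I : ∀ i, ModelWithCorners ℝ (E i) (H i)}
  {M : ι → Type*} [∀ i, TopologicalSpace (M i)] [∀ i, ChartedSpace (H i) (M i)]
  [∀ i, (I i).Boundaryless]

/-- Restrict the test function to the slice through `x` in the i-th direction: since the other
coordinates of `x` lie in their sets, the slice meets the product exactly in `A i`. -/
theorem frechetSubdiff_charFun_pi {A : ∀ i, Set (M i)} {x : ∀ i, M i} (hx : x ∈ univ.pi A)
    {P : Cotangent (ModelWithCorners.pi I) x}
    (hP : P ∈ frechetSubdiff (ModelWithCorners.pi I) (charFun (univ.pi A)) x) (i : ι) :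
    (P.toModel.comp (ContinuousLinearMap.single ℝ E i) : E i →L[ℝ] ℝ) ∈
      frechetSubdiff (I i) (charFun (A i)) (x i) := by
  have := boundaryless_pi (I := I)
  obtain ⟨g, hg, rfl, hmin⟩ := hP
  have hgi : ContMDiff (I i) 𝓘(ℝ, ℝ) 1 (g ∘ Function.update x i) := hg.comp (contMDiff_update x i)
  refine ⟨g ∘ Function.update x i, hgi, ?_, ?_⟩
  · have h1 : HasMFDerivTo (ModelWithCorners.pi I) 𝓘(ℝ, ℝ) g x (g x)
        (mfderiv (ModelWithCorners.pi I) 𝓘(ℝ, ℝ) g x) :=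
      hasMFDerivTo_self_iff.2 ((hg.mdifferentiable (by simp)) x).hasMFDerivAt
    have h2 := h1.comp (hasMFDerivTo_update x i)
    have h3 := hasMFDerivTo_self_iff.2 ((hgi.mdifferentiable (by simp)) (x i)).hasMFDerivAt
    rw [Function.comp_apply, Function.update_eq_self] at h3
    exact h2.unique h3
  · have hc : Tendsto (Function.update x i) (𝓝 (x i)) (𝓝 x) := by
      have := (hasMFDerivTo_update (I := I) x i).continuousAt.tendsto
      rwa [Function.update_eq_self] at this
    filter_upwards [hc.eventually hmin] with y hy
    have e : ∀ y, charFun (univ.pi A) (Function.update x i y) = charFun (A i) y := fun y => by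
      have : Function.update x i y ∈ univ.pi A ↔ y ∈ A i := by
        refine ⟨fun h => by simpa using h i (mem_univ i), fun h j _ => ?_⟩
        rcases eq_or_ne j i with rfl | hj
        · simpa using h
        · simpa [hj] using hx j (mem_univ j)
      simp only [charFun]
      split_ifs <;> tauto
    have e' := e (x i)
    rw [Function.update_eq_self] at e'
    simp only [e, e'] at hy
    simpa [Function.update_eq_self] using hy

variable [∀ i, IsManifold (I i) ∞ (M i)]

/-- Limiting normals to a product restrict to limiting normals to the factors. -/
theorem limitingNormalCone_pi {A : ∀ i, Set (M i)} {u : ∀ i, M i} (hu : u ∈ univ.pi A)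
    {P : Cotangent (ModelWithCorners.pi I) u}
    (hP : P ∈ limitingNormalCone (ModelWithCorners.pi I) (univ.pi A) u) (i : ι) :
    (P.toModel.comp (ContinuousLinearMap.single ℝ E i) : E i →L[ℝ] ℝ) ∈
      limitingNormalCone (I i) (A i) (u i) := by
  have := boundaryless_pi (I := I)
  obtain ⟨x, p, hp, hfx, hxp⟩ := hP
  obtain ⟨hx, hpt⟩ := tendsto_cotangent_iff.1 hxp
  -- Convergence of the values to 0 excludes the value `⊤`.
  have hmem : ∀ᶠ k in atTop, x k ∈ univ.pi A := by
    rw [show charFun (univ.pi A) u = 0 from if_pos hu] at hfx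
    filter_upwards [hfx.eventually (gt_mem_nhds (EReal.coe_lt_top 0))] with k hk
    by_contra hn
    simp [charFun, if_neg hn] at hk
  have hsrc : ∀ᶠ k in atTop, ∀ i, x k i ∈ (extChartAt (I i) (u i)).source :=
    eventually_all.2 fun i => ((continuous_apply i).tendsto u).comp hx
      |>.eventually (extChartAt_source_mem_nhds (u i))
  obtain ⟨k₀, hk₀⟩ := eventually_atTop.1 (hmem.and hsrc)
  have hle : ∀ k, k₀ ≤ k + k₀ := fun k => Nat.le_add_left _ _
  have hshift : Tendsto (fun k => k + k₀) atTop atTop := tendsto_add_atTop_nat k₀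
  refine ⟨fun k => x (k + k₀) i,
    fun k => (p (k + k₀)).toModel.comp (ContinuousLinearMap.single ℝ E i),
    fun k => frechetSubdiff_charFun_pi (hk₀ _ (hle k)).1 (hp _) i, ?_, ?_⟩
  · have h1 : ∀ k, charFun (A i) (x (k + k₀) i) = charFun (A i) (u i) := fun k => by
      rw [charFun, charFun, if_pos ((hk₀ _ (hle k)).1 i (mem_univ i)), if_pos (hu i (mem_univ i))]
    simp only [h1]
    exact tendsto_const_nhds
  · refine tendsto_cotangent_iff.2
      ⟨(((continuous_apply i).tendsto u).comp hx).comp hshift, ?_⟩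
    have h1 := (((ContinuousLinearMap.compL ℝ (E i) (∀ i, E i) ℝ).flip
      (ContinuousLinearMap.single ℝ E i)).continuous.tendsto _).comp (hpt.comp hshift)
    refine h1.congr fun k => ?_
    ext w
    simp only [Function.comp_apply, ContinuousLinearMap.flip_apply,
      ContinuousLinearMap.compL_apply, ContinuousLinearMap.comp_apply,
      ContinuousLinearMap.single_apply]
    rw [tangentCoordChange_pi_single (hk₀ _ (hle k)).2
      (fun j => mem_extChartAt_source (x (k + k₀) j))]
    rfl

/-- A normal to the product evaluates on `v` as the sum of its restrictions on the `v i`, each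
nonpositive. Only this inclusion is needed to test criticality. -/
theorem mem_clarkeTangentCone_pi {A : ∀ i, Set (M i)} {u : ∀ i, M i} (hu : u ∈ univ.pi A)
    {v : ∀ i, E i} (hv : ∀ i, v i ∈ clarkeTangentCone (I i) (A i) (u i)) :
    v ∈ clarkeTangentCone (ModelWithCorners.pi I) (univ.pi A) u := by
  intro P hP
  have h1 : (P.toModel v : ℝ) = ∑ i, P.toModel (Pi.single i (v i)) := by
    rw [← map_sum, Finset.univ_sum_single]
  refine (show P.toModel v ≤ 0 from ?_)
  rw [h1]
  exact Finset.sum_nonpos fun i _ => hv i _ (limitingNormalCone_pi hu hP i)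

end ClarkeProduct

/-! ### Smooth curves, Lipschitz functions in charts and difference quotients. -/

section Curves

variable {E : Type*} [NormedAddCommGroup E] [NormedSpace ℝ E] {H : Type*} [TopologicalSpace H]
  {I : ModelWithCorners ℝ E H} {M : Type*} [TopologicalSpace M] [ChartedSpace H M]

theorem isClosed_clarkeTangentCone [IsManifold I 1 M] (A : Set M) (q : M) :
    IsClosed (clarkeTangentCone I A q : Set E) := by
  have : IsClosed {v : E | ∀ p ∈ limitingNormalCone I A q, Cotangent.toModel p v ≤ 0} := by
    simp only [ofPred_forall]
    exact isClosed_biInter fun p _ => isClosed_le (Cotangent.toModel p).continuous continuous_const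
  exact this

variable (I) in
/-- `f`, read in the preferred chart at `q`, is Lipschitz near `q`. -/
def LipschitzInChartAt (f : M → ℝ) (q : M) : Prop :=
  ∃ K : ℝ≥0, ∃ s ∈ 𝓝 (extChartAt I q q), LipschitzOnWith K (f ∘ (extChartAt I q).symm) s

theorem LipschitzInChartAt.continuousAt {f : M → ℝ} {q : M} (h : LipschitzInChartAt I f q) :
    ContinuousAt f q := by
  obtain ⟨K, s, hs, hK⟩ := h
  have h1 : ContinuousAt (f ∘ (extChartAt I q).symm) (extChartAt I q q) :=
    hK.continuousOn.continuousAt hs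
  refine (h1.comp (continuousAt_extChartAt q)).congr ?_
  filter_upwards [extChartAt_source_mem_nhds (I := I) q] with x hx
  simp only [Function.comp_apply, (extChartAt I q).left_inv hx]

theorem le_liminf_of_le_lowerDini {f : M → ℝ} {q : M} {v : TangentSpace I q} {a : EReal}
    (h : a ≤ lowerDini I f q v) {c : ℝ → M} (hc : ContMDiff 𝓘(ℝ, ℝ) I ∞ c)
    (hcv : HasMFDerivTo 𝓘(ℝ, ℝ) I c 0 q (.toSpanSingleton ℝ (show E from v))) :
    a ≤ liminf (fun t : ℝ => (((f (c t) - f q) / t : ℝ) : EReal)) (𝓝[>] 0) := by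
  refine h.trans (iInf_le_of_le c (iInf_le_of_le hc (iInf_le_of_le ?_ le_rfl)))
  obtain rfl := hcv.map_eq
  have := (hasMFDerivTo_self_iff.1 hcv).mfderiv
  rw [this]
  exact congrArg _ (one_smul ℝ _)

/-- Difference quotients of a function that is Lipschitz in a chart only depend, in the limit, on
the velocity of the curve. -/
theorem LipschitzInChartAt.tendsto_quotient_sub {f : M → ℝ} {q : M}
    (hf : LipschitzInChartAt I f q) {c : ℝ → M} {v : E}
    (hc : HasMFDerivTo 𝓘(ℝ, ℝ) I c 0 q (.toSpanSingleton ℝ v)) :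
    Tendsto (fun t : ℝ => (f (c t) - (f ∘ (extChartAt I q).symm) (extChartAt I q q + t • v)) / t)
      (𝓝[>] 0) (𝓝 0) := by
  obtain ⟨K, s, hs, hK⟩ := hf
  have hd : HasDerivAt (extChartAt I q ∘ c) v 0 := by
    have := hc.hasFDerivAt
    exact this.hasDerivAt.congr_deriv (one_smul ℝ v)
  have hc0 : Tendsto c (𝓝 0) (𝓝 q) := by
    have := hc.continuousAt.tendsto
    rwa [hc.map_eq] at this
  have e1 : ∀ᶠ t in 𝓝 (0 : ℝ), c t ∈ (extChartAt I q).source :=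
    hc0.eventually (extChartAt_source_mem_nhds q)
  have e2 : ∀ᶠ t in 𝓝 (0 : ℝ), extChartAt I q (c t) ∈ s :=
    ((continuousAt_extChartAt q).tendsto.comp hc0).eventually hs
  have e3 : ∀ᶠ t in 𝓝 (0 : ℝ), extChartAt I q q + t • v ∈ s := by
    have hcc : Continuous fun t : ℝ => extChartAt I q q + t • v := by fun_prop
    exact hcc.continuousAt.eventually (by simpa using hs)
  have hlim : Tendsto (fun t : ℝ => K * ‖t⁻¹ • ((extChartAt I q ∘ c) (0 + t) -
      (extChartAt I q ∘ c) 0) - v‖) (𝓝[>] 0) (𝓝 (K * ‖v - v‖)) :=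
    (((hasDerivAt_iff_tendsto_slope_zero.1 hd).mono_left
      (nhdsWithin_mono 0 fun t (ht : 0 < t) => ht.ne')).sub_const v).norm.const_mul _
  rw [sub_self, norm_zero, mul_zero] at hlim
  refine squeeze_zero_norm' ?_ hlim
  filter_upwards [nhdsWithin_le_nhds e1, nhdsWithin_le_nhds e2, nhdsWithin_le_nhds e3,
    self_mem_nhdsWithin] with t h1 h2 h3 ht
  have ht' : (0 : ℝ) < t := ht
  have h4 := hK.dist_le_mul _ h2 _ h3
  rw [Function.comp_apply, (extChartAt I q).left_inv h1, dist_eq_norm, dist_eq_norm] at h4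
  rw [norm_div, Real.norm_of_nonneg ht'.le, div_le_iff₀ ht']
  refine h4.trans_eq ?_
  rw [mul_assoc]
  congr 1
  rw [mul_comm, ← Real.norm_of_nonneg ht'.le, ← norm_smul, Real.norm_of_nonneg ht'.le, smul_sub,
    smul_inv_smul₀ ht'.ne', zero_add, Function.comp_apply, Function.comp_apply, hc.map_eq, sub_sub]

variable [I.Boundaryless] [IsManifold I ∞ M]

/-- The chart supplied by the hypothesis is arbitrary; its transition map to the preferred chart is
C^1, hence Lipschitz near the point. -/
theorem IsLocallyLipschitz.lipschitzInChartAt {f : M → ℝ} (hf : IsLocallyLipschitz I f) (q : M) :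
    LipschitzInChartAt I f q := by
  obtain ⟨e, he, hqe, K, hK⟩ := hf q
  have h1 : ContDiffAt ℝ 1 (e.extend I ∘ (extChartAt I q).symm) (extChartAt I q q) := by
    have := ModelWithCorners.contDiffWithinAt_extendCoordChange' (n := ∞) (I := I)
      (IsManifold.chart_mem_maximalAtlas (I := I) (n := ∞) q) he (mem_chart_source H q) hqe
    rw [I.range_eq_univ, contDiffWithinAt_univ] at this
    exact this.of_le (by exact_mod_cast le_top)
  obtain ⟨K', t, ht, hK'⟩ := h1.exists_lipschitzOnWith
  have hmaps : (e.extend I ∘ (extChartAt I q).symm) ⁻¹' (e.extend I).target ∈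
      𝓝 (extChartAt I q q) := by
    refine h1.continuousAt.preimage_mem_nhds ?_
    rw [Function.comp_apply, extChartAt_to_inv]
    have := e.extend_target_mem_nhdsWithin (I := I) hqe
    rwa [I.range_eq_univ, nhdsWithin_univ] at this
  have hsrc : (extChartAt I q).symm ⁻¹' e.source ∈ 𝓝 (extChartAt I q q) := by
    refine (continuousAt_extChartAt_symm q).preimage_mem_nhds ?_
    rw [extChartAt_to_inv]
    exact e.open_source.mem_nhds hqe
  refine ⟨K * K', _, inter_mem (inter_mem ht hmaps) hsrc, ?_⟩
  have h2 := hK.comp (hK'.mono fun x hx => hx.1.1) (s := (t ∩ (e.extend I ∘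
    (extChartAt I q).symm) ⁻¹' (e.extend I).target) ∩ (extChartAt I q).symm ⁻¹' e.source)
    fun x hx => hx.1.2
  intro x hx y hy
  have := h2 hx hy
  simp only [Function.comp_apply] at this ⊢
  rwa [e.extend_left_inv hx.2, e.extend_left_inv hy.2] at this

/-- A straight line may leave the chart, while the curve must be defined on all of ℝ. Replacing t by
δ sin(t/δ) keeps the velocity at 0 and confines the displacement to δ ‖v‖. -/
theorem exists_contMDiff_curve (q : M) (v : E) :
    ∃ c : ℝ → M, ContMDiff 𝓘(ℝ, ℝ) I ∞ c ∧
      HasMFDerivTo 𝓘(ℝ, ℝ) I c 0 q (.toSpanSingleton ℝ v) := by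
  obtain ⟨r, hr, hball⟩ := Metric.mem_nhds_iff.1 (extChartAt_target_mem_nhds (I := I) q)
  obtain ⟨δ, hδ, hδr⟩ : ∃ δ > 0, δ * ‖v‖ < r := by
    refine ⟨r / (‖v‖ + 1), by positivity, ?_⟩
    rw [div_mul_eq_mul_div, div_lt_iff₀ (by positivity)]
    nlinarith [norm_nonneg v]
  let γ : ℝ → E := fun t => extChartAt I q q + (δ * Real.sin (t / δ)) • v
  have hγ : ContDiff ℝ ∞ γ :=
    contDiff_const.add ((contDiff_const.mul (Real.contDiff_sin.comp
      (contDiff_id.div_const δ))).smul contDiff_const)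
  have hγt : ∀ t, γ t ∈ (extChartAt I q).target := fun t => hball <| by
    rw [mem_ball_iff_norm, add_sub_cancel_left, norm_smul, norm_mul, Real.norm_of_nonneg hδ.le]
    have := Real.abs_sin_le_one (t / δ)
    rw [← Real.norm_eq_abs] at this
    refine lt_of_le_of_lt ?_ hδr
    gcongr
    nlinarith
  have hγ0 : γ 0 = extChartAt I q q := by simp [γ]
  have hc : ContMDiff 𝓘(ℝ, ℝ) I ∞ ((extChartAt I q).symm ∘ γ) :=
    (contMDiffOn_extChartAt_symm q).comp_contMDiff hγ.contMDiff hγt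
  refine ⟨(extChartAt I q).symm ∘ γ, hc, by simp [hγ0], hc.continuous.continuousAt, ?_⟩
  have h1 : HasDerivAt γ v 0 := by
    have h2 : HasDerivAt (fun t : ℝ => t / δ) (1 / δ) 0 := (hasDerivAt_id 0).div_const δ
    have h3 := (((Real.hasDerivAt_sin (0 / δ)).comp 0 h2).const_mul δ).smul_const v
    have h4 := h3.const_add (extChartAt I q q)
    refine h4.congr_deriv ?_
    rw [zero_div, Real.cos_zero, one_mul, mul_one_div_cancel hδ.ne', one_smul]
  refine h1.hasFDerivAt.congr_of_eventuallyEq (Eventually.of_forall fun t => ?_)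
  simp only [Function.comp_apply, extChartAt_model_space_eq_id, PartialEquiv.refl_symm,
    PartialEquiv.refl_coe, id]
  exact (extChartAt I q).right_inv (hγt t)

end Curves

/-! ### Sums of functions that are Lipschitz near a point. -/

section LocallyLipschitzSums

/-- `f` is Lipschitz on a neighbourhood of `x`. -/
def LipschitzNear {E : Type*} [PseudoEMetricSpace E] (f : E → ℝ) (x : E) : Prop :=
  ∃ K : ℝ≥0, ∃ s ∈ 𝓝 x, LipschitzOnWith K f s

theorem LipschitzNear.add {E : Type*} [PseudoEMetricSpace E] {f g : E → ℝ} {x : E}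
    (hf : LipschitzNear f x) (hg : LipschitzNear g x) : LipschitzNear (fun y => f y + g y) x := by
  obtain ⟨K, s, hs, hf⟩ := hf
  obtain ⟨K', t, ht, hg⟩ := hg
  exact ⟨_, _, inter_mem hs ht, (hf.mono inter_subset_left).add (hg.mono inter_subset_right)⟩

theorem LipschitzNear.sum {E : Type*} [PseudoEMetricSpace E] {ι : Type*} (s : Finset ι)
    {f : ι → E → ℝ} {x : E} (hf : ∀ i, LipschitzNear (f i) x) :
    LipschitzNear (fun y => ∑ i ∈ s, f i y) x := by
  classical
  induction s using Finset.induction_on with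
  | empty => exact ⟨0, univ, univ_mem, by simp⟩
  | insert i s hi ih => simpa only [Finset.sum_insert hi] using (hf i).add ih

theorem LipschitzNear.comp_clm {E E' : Type*} [NormedAddCommGroup E] [NormedSpace ℝ E]
    [NormedAddCommGroup E'] [NormedSpace ℝ E'] {f : E' → ℝ} (T : E →L[ℝ] E') {x : E}
    (hf : LipschitzNear f (T x)) : LipschitzNear (fun y => f (T y)) x := by
  obtain ⟨K, s, hs, hf⟩ := hf
  exact ⟨_, _, T.continuous.continuousAt.preimage_mem_nhds hs,
    hf.comp T.lipschitz.lipschitzOnWith fun y hy => hy⟩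

end LocallyLipschitzSums

theorem HasMFDerivTo.comp_curve {E : Type*} [NormedAddCommGroup E] [NormedSpace ℝ E] {H : Type*}
    [TopologicalSpace H] {I : ModelWithCorners ℝ E H} {M : Type*} [TopologicalSpace M]
    [ChartedSpace H M] {E' : Type*} [NormedAddCommGroup E'] [NormedSpace ℝ E'] {H' : Type*}
    [TopologicalSpace H'] {I' : ModelWithCorners ℝ E' H'} {M' : Type*} [TopologicalSpace M']
    [ChartedSpace H' M'] [I.Boundaryless] {f : M → M'} {x : M} {y : M'} {f' : E →L[ℝ] E'}
    (hf : HasMFDerivTo I I' f x y f') {c : ℝ → M} {v : E}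
    (hc : HasMFDerivTo 𝓘(ℝ, ℝ) I c 0 x (.toSpanSingleton ℝ v)) :
    HasMFDerivTo 𝓘(ℝ, ℝ) I' (fun t => f (c t)) 0 y (.toSpanSingleton ℝ (f' v)) := by
  have := hf.comp hc
  rwa [ContinuousLinearMap.comp_toSpanSingleton] at this

/-! ### Linearisation of the dynamics. -/

namespace ControlProblem

theorem state_succ {n : ℕ} {Q : Type*} {U : Fin n → Type*} (P : ControlProblem n Q U) (q₀ : Q)
    (u : ∀ i, U i) (i : Fin n) :
    P.state q₀ u i.succ = P.F i (P.state q₀ u i.castSucc, u i) := by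
  simp [state]

variable {n : ℕ} {EQ : Type*} [NormedAddCommGroup EQ] [NormedSpace ℝ EQ]
  {Q : Type*} [TopologicalSpace Q] [ChartedSpace EQ Q]
  {EU : Fin n → Type*} [∀ i, NormedAddCommGroup (EU i)] [∀ i, NormedSpace ℝ (EU i)]
  {U : Fin n → Type*} [∀ i, TopologicalSpace (U i)] [∀ i, ChartedSpace (EU i) (U i)]
  (P : ControlProblem n Q U) (q₀ : Q) (u : ∀ i, U i)

variable (EQ) in
/-- The partial derivative `D_q F_i`, read in the preferred charts. -/
noncomputable def DqFModel (i : Fin n) : EQ →L[ℝ] EQ :=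
  mfderiv 𝓘(ℝ, EQ) 𝓘(ℝ, EQ) (fun q => P.F i (q, u i)) (P.state q₀ u i.castSucc)

variable (EQ EU) in
/-- The partial derivative `D_u F_i`, read in the preferred charts. -/
noncomputable def DuFModel (i : Fin n) : EU i →L[ℝ] EQ :=
  mfderiv 𝓘(ℝ, EU i) 𝓘(ℝ, EQ) (fun c => P.F i (P.state q₀ u i.castSucc, c)) (u i)

variable (EQ EU) in
/-- The derivatives of the states with respect to the initial state and the controls. -/
noncomputable def stateDeriv : Fin (n + 1) → (EQ × (∀ i, EU i) →L[ℝ] EQ) :=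
  Fin.induction (motive := fun _ => EQ × (∀ i, EU i) →L[ℝ] EQ) (ContinuousLinearMap.fst ℝ _ _)
    fun i A => (P.DqFModel EQ q₀ u i).comp A + (P.DuFModel EQ EU q₀ u i).comp
      ((ContinuousLinearMap.proj i).comp (ContinuousLinearMap.snd ℝ _ _))

theorem stateDeriv_zero (x : EQ × (∀ i, EU i)) : P.stateDeriv EQ EU q₀ u 0 x = x.1 := rfl

theorem stateDeriv_succ (i : Fin n) (x : EQ × (∀ i, EU i)) :
    P.stateDeriv EQ EU q₀ u i.succ x =
      P.DqFModel EQ q₀ u i (P.stateDeriv EQ EU q₀ u i.castSucc x) +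
        P.DuFModel EQ EU q₀ u i (x.2 i) := by
  simp [stateDeriv]

-- The chain rule along the recursion for the states; the derivative of each F_i splits into the two
-- partial derivatives, obtained by composing with the slices through the base point.
variable {q₀ u} in
theorem hasMFDerivTo_state
    (hF : ∀ i, ContMDiff (𝓘(ℝ, EQ).prod 𝓘(ℝ, EU i)) 𝓘(ℝ, EQ) 1 (P.F i))
    {cQ : ℝ → Q} {cU : ∀ i, ℝ → U i} {x : EQ × (∀ i, EU i)}
    (hQ : HasMFDerivTo 𝓘(ℝ, ℝ) 𝓘(ℝ, EQ) cQ 0 q₀ (.toSpanSingleton ℝ x.1))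
    (hU : ∀ i, HasMFDerivTo 𝓘(ℝ, ℝ) 𝓘(ℝ, EU i) (cU i) 0 (u i) (.toSpanSingleton ℝ (x.2 i)))
    (j : Fin (n + 1)) :
    HasMFDerivTo 𝓘(ℝ, ℝ) 𝓘(ℝ, EQ) (fun t => P.state (cQ t) (fun i => cU i t) j) 0
      (P.state q₀ u j) (.toSpanSingleton ℝ (P.stateDeriv EQ EU q₀ u j x)) := by
  induction j using Fin.induction with
  | zero => exact hQ
  | succ i ih =>
    obtain ⟨F', hFi⟩ : ∃ F' : EQ × EU i →L[ℝ] EQ,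
        HasMFDerivTo (𝓘(ℝ, EQ).prod 𝓘(ℝ, EU i)) 𝓘(ℝ, EQ) (P.F i) (P.state q₀ u i.castSucc, u i)
          (P.F i (P.state q₀ u i.castSucc, u i)) F' :=
      ⟨_, hasMFDerivTo_self_iff.2 ((hF i).mdifferentiable (by simp)
        (P.state q₀ u i.castSucc, u i)).hasMFDerivAt⟩
    have h1 : F'.comp (.inl ℝ _ _) = P.DqFModel EQ q₀ u i := by
      have hp : HasMFDerivTo 𝓘(ℝ, EQ) (𝓘(ℝ, EQ).prod 𝓘(ℝ, EU i)) (fun q => (q, u i))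
          (P.state q₀ u i.castSucc) (P.state q₀ u i.castSucc, u i) (.inl ℝ _ _) :=
        (hasMFDerivTo_id _).prodMk (hasMFDerivTo_const _ _)
      have h2 := hFi.comp hp
      exact h2.unique (hasMFDerivTo_self_iff.2
        (hasMFDerivTo_self_iff.1 h2).mdifferentiableAt.hasMFDerivAt)
    have h2 : F'.comp (.inr ℝ _ _) = P.DuFModel EQ EU q₀ u i := by
      have hp : HasMFDerivTo 𝓘(ℝ, EU i) (𝓘(ℝ, EQ).prod 𝓘(ℝ, EU i))
          (fun c => (P.state q₀ u i.castSucc, c)) (u i) (P.state q₀ u i.castSucc, u i)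
          (.inr ℝ _ _) :=
        (hasMFDerivTo_const _ _).prodMk (hasMFDerivTo_id _)
      have h2 := hFi.comp hp
      exact h2.unique (hasMFDerivTo_self_iff.2
        (hasMFDerivTo_self_iff.1 h2).mdifferentiableAt.hasMFDerivAt)
    have hpair : HasMFDerivTo 𝓘(ℝ, ℝ) (𝓘(ℝ, EQ).prod 𝓘(ℝ, EU i))
        (fun t => (P.state (cQ t) (fun i => cU i t) i.castSucc, cU i t)) 0
        (P.state q₀ u i.castSucc, u i)
        (.toSpanSingleton ℝ (P.stateDeriv EQ EU q₀ u i.castSucc x, x.2 i)) :=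
      ih.prodMk (hU i)
    have h3 := hFi.comp_curve hpair
    simp only [state_succ, stateDeriv_succ, ← h1, ← h2]
    convert h3 using 2
    rw [ContinuousLinearMap.comp_apply, ContinuousLinearMap.comp_apply, ← map_add]
    simp

end ControlProblem

/-! ### Limiting subgradients of the separate cost terms. -/

namespace ControlProblem

variable {n : ℕ} {EQ : Type*} [NormedAddCommGroup EQ] [NormedSpace ℝ EQ] [FiniteDimensional ℝ EQ]
  {Q : Type*} [TopologicalSpace Q] [ChartedSpace EQ Q]
  {EU : Fin n → Type*} [∀ i, NormedAddCommGroup (EU i)] [∀ i, NormedSpace ℝ (EU i)]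
  [∀ i, FiniteDimensional ℝ (EU i)]
  {U : Fin n → Type*} [∀ i, TopologicalSpace (U i)] [∀ i, ChartedSpace (EU i) (U i)]
  (P : ControlProblem n Q U) (q₀ : Q) (u : ∀ i, U i)

/-- If the cost is almost nondecreasing along curves with velocities in a closed convex cone, there
are limiting subgradients of its terms, read in charts, satisfying the combined first-order
condition on this cone. -/
theorem exists_limitingSubgradients
    (hF : ∀ i, ContMDiff (𝓘(ℝ, EQ).prod 𝓘(ℝ, EU i)) 𝓘(ℝ, EQ) 1 (P.F i))
    (hL : ∀ i, LipschitzInChartAt (𝓘(ℝ, EQ).prod 𝓘(ℝ, EU i)) (P.L i)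
      (P.state q₀ u i.castSucc, u i))
    (hℓ : LipschitzInChartAt 𝓘(ℝ, EQ) P.ℓ (P.state q₀ u (Fin.last n)))
    (hκ : LipschitzInChartAt 𝓘(ℝ, EQ) P.κ q₀)
    {K : Set (EQ × (∀ i, EU i))} (hK : IsClosed K)
    (h0 : (0 : EQ × (∀ i, EU i)) ∈ K) (hadd : ∀ v ∈ K, ∀ w ∈ K, v + w ∈ K)
    (hsmul : ∀ s : ℝ, 0 ≤ s → ∀ v ∈ K, s • v ∈ K) {N : EQ × (∀ i, EU i) → ℝ}
    (hN : Continuous N) (hNadd : ∀ v w, N (v + w) ≤ N v + N w)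
    (hNsmul : ∀ s : ℝ, 0 ≤ s → ∀ v, N (s • v) = s * N v)
    (hcrit : ∀ x ∈ K, ∃ (cQ : ℝ → Q) (cU : ∀ i, ℝ → U i),
      HasMFDerivTo 𝓘(ℝ, ℝ) 𝓘(ℝ, EQ) cQ 0 q₀ (.toSpanSingleton ℝ x.1) ∧
      (∀ i, HasMFDerivTo 𝓘(ℝ, ℝ) 𝓘(ℝ, EU i) (cU i) 0 (u i) (.toSpanSingleton ℝ (x.2 i))) ∧
      ((-N x : ℝ) : EReal) ≤ liminf (fun t : ℝ =>
        (((P.cost (cQ t, fun i => cU i t) - P.cost (q₀, u)) / t : ℝ) : EReal)) (𝓝[>] 0)) :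
    ∃ (β α : EQ →L[ℝ] ℝ) (a : Fin n → EQ →L[ℝ] ℝ) (b : ∀ i, EU i →L[ℝ] ℝ),
      IsLimitingSubgradient (P.κ ∘ (extChartAt 𝓘(ℝ, EQ) q₀).symm) (extChartAt 𝓘(ℝ, EQ) q₀ q₀) β ∧
      IsLimitingSubgradient (P.ℓ ∘ (extChartAt 𝓘(ℝ, EQ) (P.state q₀ u (Fin.last n))).symm)
        (extChartAt 𝓘(ℝ, EQ) (P.state q₀ u (Fin.last n)) (P.state q₀ u (Fin.last n))) α ∧
      (∀ i, IsLimitingSubgradient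
        (P.L i ∘ (extChartAt (𝓘(ℝ, EQ).prod 𝓘(ℝ, EU i)) (P.state q₀ u i.castSucc, u i)).symm)
        (extChartAt (𝓘(ℝ, EQ).prod 𝓘(ℝ, EU i)) (P.state q₀ u i.castSucc, u i)
          (P.state q₀ u i.castSucc, u i)) ((a i).coprod (b i))) ∧
      ∀ x ∈ K, -N x ≤ β x.1 + α (P.stateDeriv EQ EU q₀ u (Fin.last n) x) +
        ∑ i, (a i (P.stateDeriv EQ EU q₀ u i.castSucc x) + b i (x.2 i)) := by
  let fκ : EQ → ℝ := P.κ ∘ (extChartAt 𝓘(ℝ, EQ) q₀).symm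
  let qn := P.state q₀ u (Fin.last n)
  let fℓ : EQ → ℝ := P.ℓ ∘ (extChartAt 𝓘(ℝ, EQ) qn).symm
  let z : ∀ i : Fin n, Q × U i := fun i => (P.state q₀ u i.castSucc, u i)
  let fL : ∀ i, EQ × EU i → ℝ := fun i =>
    P.L i ∘ (extChartAt (𝓘(ℝ, EQ).prod 𝓘(ℝ, EU i)) (z i)).symm
  -- Every cost term receives its own copy of the variables; the coupling through the dynamics
  -- survives only in the linear map `A`.
  let f : (EQ × EQ) × (∀ i, EQ × EU i) → ℝ := fun x => fκ x.1.1 + fℓ x.1.2 + ∑ i, fL i (x.2 i)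
  let y : (EQ × EQ) × (∀ i, EQ × EU i) := ((extChartAt 𝓘(ℝ, EQ) q₀ q₀, extChartAt 𝓘(ℝ, EQ) qn qn),
    fun i => extChartAt (𝓘(ℝ, EQ).prod 𝓘(ℝ, EU i)) (z i) (z i))
  let AL : ∀ i, EQ × (∀ i, EU i) →L[ℝ] EQ × EU i := fun i =>
    (P.stateDeriv EQ EU q₀ u i.castSucc).prod
      ((ContinuousLinearMap.proj i).comp (ContinuousLinearMap.snd ℝ _ _))
  let A : EQ × (∀ i, EU i) →L[ℝ] (EQ × EQ) × (∀ i, EQ × EU i) :=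
    ((ContinuousLinearMap.fst ℝ _ _).prod (P.stateDeriv EQ EU q₀ u (Fin.last n))).prod
      (ContinuousLinearMap.pi AL)
  have hf : LipschitzNear f y := by
    refine LipschitzNear.add (LipschitzNear.add ?_ ?_) (LipschitzNear.sum _ fun i => ?_)
    · exact LipschitzNear.comp_clm ((ContinuousLinearMap.fst ℝ EQ EQ).comp
        (ContinuousLinearMap.fst ℝ _ (∀ i, EQ × EU i))) (x := y) hκ
    · exact LipschitzNear.comp_clm ((ContinuousLinearMap.snd ℝ EQ EQ).comp
        (ContinuousLinearMap.fst ℝ _ (∀ i, EQ × EU i))) (x := y) hℓ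
    · exact LipschitzNear.comp_clm ((ContinuousLinearMap.proj (φ := fun i => EQ × EU i) i).comp
        (ContinuousLinearMap.snd ℝ (EQ × EQ) (∀ i, EQ × EU i))) (x := y) (hL i)
  obtain ⟨C, s, hs, hC⟩ := hf
  obtain ⟨r, hr, hrs⟩ := Metric.mem_nhds_iff.1 hs
  have hfC : ∀ x ∈ Metric.ball y r, ∀ x' ∈ Metric.ball y r, |f x - f x'| ≤ C * ‖x - x'‖ :=
    fun x hx x' hx' => by
      rw [← Real.dist_eq, ← dist_eq_norm]
      exact hC.dist_le_mul x (hrs hx) x' (hrs hx')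
  have hfy : f y = P.cost (q₀, u) := by
    simp only [f, y, fκ, fℓ, fL, Function.comp_apply, extChartAt_to_inv, cost, qn, z]
  -- The cost along the curve and `f` along the line with velocity `A x` differ by o(t), term by
  -- term.
  have hquot : ∀ x ∈ K, ∀ ε > 0, ∀ᶠ t in 𝓝[>] (0 : ℝ), -N x - ε ≤ (f (y + t • A x) - f y) / t := by
    intro x hx ε hε
    obtain ⟨cQ, cU, hcQ, hcU, hlim⟩ := hcrit x hx
    have hst := P.hasMFDerivTo_state hF hcQ hcU
    have h1 := hκ.tendsto_quotient_sub hcQ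
    have h2 := hℓ.tendsto_quotient_sub (hst (Fin.last n))
    have hpair : ∀ i, HasMFDerivTo 𝓘(ℝ, ℝ) (𝓘(ℝ, EQ).prod 𝓘(ℝ, EU i))
        (fun t => (P.state (cQ t) (fun i => cU i t) i.castSucc, cU i t)) 0 (z i)
        (.toSpanSingleton ℝ (AL i x)) := fun i => (hst i.castSucc).prodMk (hcU i)
    have h3 := tendsto_finsetSum Finset.univ fun i _ => (hL i).tendsto_quotient_sub (hpair i)
    have h4 := (h1.add h2).add h3
    rw [Finset.sum_const_zero, add_zero, add_zero] at h4
    have h5 := eventually_lt_of_lt_liminf (lt_of_lt_of_le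
      (EReal.coe_lt_coe_iff.2 (show -N x - ε / 2 < -N x by linarith)) hlim)
    filter_upwards [h4.eventually (gt_mem_nhds (show (0 : ℝ) < ε / 2 by linarith)), h5]
      with t h6 h7
    rw [EReal.coe_lt_coe_iff] at h7
    have h8 : P.cost (cQ t, fun i => cU i t) - f (y + t • A x) =
        P.κ (cQ t) - fκ (extChartAt 𝓘(ℝ, EQ) q₀ q₀ + t • x.1) +
        (P.ℓ (P.state (cQ t) (fun i => cU i t) (Fin.last n)) -
          fℓ (extChartAt 𝓘(ℝ, EQ) qn qn + t • P.stateDeriv EQ EU q₀ u (Fin.last n) x)) +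
        ∑ i, (P.L i (P.state (cQ t) (fun i => cU i t) i.castSucc, cU i t) -
          fL i (extChartAt (𝓘(ℝ, EQ).prod 𝓘(ℝ, EU i)) (z i) (z i) + t • AL i x)) := by
      rw [Finset.sum_sub_distrib]
      simp only [cost]
      have : f (y + t • A x) = fκ (extChartAt 𝓘(ℝ, EQ) q₀ q₀ + t • x.1) +
          fℓ (extChartAt 𝓘(ℝ, EQ) qn qn + t • P.stateDeriv EQ EU q₀ u (Fin.last n) x) +
          ∑ i, fL i (extChartAt (𝓘(ℝ, EQ).prod 𝓘(ℝ, EU i)) (z i) (z i) + t • AL i x) := rfl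
      rw [this]
      ring
    have h9 : (f (y + t • A x) - f y) / t = (P.cost (cQ t, fun i => cU i t) - P.cost (q₀, u)) / t -
        (P.cost (cQ t, fun i => cU i t) - f (y + t • A x)) / t := by
      rw [hfy]; ring
    rw [h9, h8, add_div, add_div, Finset.sum_div]
    refine le_of_lt ?_
    have h10 := sub_lt_sub h7 h6
    refine lt_of_eq_of_lt ?_ h10
    ring
  obtain ⟨p, hp, hpK⟩ := exists_stationary_limitingSubgradient hK h0 hadd hsmul hN hNadd hNsmul hr
    C.2 hfC hquot
  let iκ : EQ →L[ℝ] (EQ × EQ) × (∀ i, EQ × EU i) :=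
    (ContinuousLinearMap.inl ℝ _ _).comp (.inl ℝ _ _)
  let iℓ : EQ →L[ℝ] (EQ × EQ) × (∀ i, EQ × EU i) :=
    (ContinuousLinearMap.inl ℝ _ _).comp (.inr ℝ _ _)
  let iL : ∀ i, EQ × EU i →L[ℝ] (EQ × EQ) × (∀ i, EQ × EU i) := fun i =>
    (ContinuousLinearMap.inr ℝ _ _).comp (.single ℝ (fun i => EQ × EU i) i)
  refine ⟨p.comp iκ, p.comp iℓ, fun i => (p.comp (iL i)).comp (.inl ℝ _ _),
    fun i => (p.comp (iL i)).comp (.inr ℝ _ _), ?_, ?_, fun i => ?_, fun x hx => ?_⟩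
  · refine hp.restrict (f₁ := fκ) (pr := (ContinuousLinearMap.fst ℝ EQ EQ).comp
      (ContinuousLinearMap.fst ℝ _ _)) fun x h => ?_
    simp [f, iκ]
  · refine hp.restrict (f₁ := fℓ) (pr := (ContinuousLinearMap.snd ℝ EQ EQ).comp
      (ContinuousLinearMap.fst ℝ _ _)) fun x h => ?_
    simp [f, iℓ]
  · have := hp.restrict (f₁ := fL i) (i := iL i)
      (pr := (ContinuousLinearMap.proj (φ := fun i => EQ × EU i) i).comp
      (ContinuousLinearMap.snd ℝ (EQ × EQ) (∀ i, EQ × EU i))) fun x h => ?_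
    · rwa [← ContinuousLinearMap.coprod_comp_inl_inr (p.comp (iL i))] at this
    · simp only [f, iL, ContinuousLinearMap.comp_apply, ContinuousLinearMap.inr_apply,
        ContinuousLinearMap.single_apply, Prod.fst_add, Prod.snd_add,
        add_zero, Pi.add_apply, ContinuousLinearMap.proj_apply, ContinuousLinearMap.coe_snd']
      rw [add_sub_add_left_eq_sub, ← Finset.sum_sub_distrib, Finset.sum_eq_single i]
      · simp
      · intro j _ hj
        simp [hj]
      · simp
  · refine (hpK x hx).trans_eq ?_
    have hAx : A x = iκ x.1 + iℓ (P.stateDeriv EQ EU q₀ u (Fin.last n) x) +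
        ∑ i, (iL i (P.stateDeriv EQ EU q₀ u i.castSucc x, 0) + iL i (0, x.2 i)) := by
      have h1 : ∀ i, iL i (P.stateDeriv EQ EU q₀ u i.castSucc x, 0) + iL i (0, x.2 i) =
          ContinuousLinearMap.inr ℝ _ _ (Pi.single i (AL i x)) := fun i => by
        rw [← map_add, Prod.mk_add_mk, add_zero, zero_add]; rfl
      simp only [h1]
      rw [← map_sum, Finset.univ_sum_single]
      simp [A, iκ, iℓ]
    rw [hAx, map_add, map_add, map_sum]
    simp only [map_add]
    rfl

end ControlProblem

/-! ### Closed convex cones and seminorms of bilinear forms. -/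

section Cones

/-- Closed convex cones containing the origin. -/
structure IsClosedConvexCone {V : Type*} [NormedAddCommGroup V] [NormedSpace ℝ V] (K : Set V) :
    Prop where
  isClosed : IsClosed K
  zero_mem : 0 ∈ K
  add_mem : ∀ v ∈ K, ∀ w ∈ K, v + w ∈ K
  smul_mem : ∀ s : ℝ, 0 ≤ s → ∀ v ∈ K, s • v ∈ K

theorem isClosedConvexCone_zero {V : Type*} [NormedAddCommGroup V] [NormedSpace ℝ V] :
    IsClosedConvexCone ({0} : Set V) :=
  ⟨isClosed_singleton, rfl, by simp, by simp⟩

theorem isClosedConvexCone_clarkeTangentCone {E : Type*} [NormedAddCommGroup E] [NormedSpace ℝ E]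
    {H : Type*} [TopologicalSpace H] (I : ModelWithCorners ℝ E H) {M : Type*} [TopologicalSpace M]
    [ChartedSpace H M] [IsManifold I 1 M] (A : Set M) (q : M) :
    IsClosedConvexCone (V := E) (clarkeTangentCone I A q) where
  isClosed := isClosed_clarkeTangentCone A q
  zero_mem := fun p _ => (map_zero p.toModel).le
  add_mem := fun v hv w hw p hp =>
    (map_add p.toModel v w).trans_le (add_nonpos (hv p hp) (hw p hp))
  smul_mem := fun s hs v hv p hp =>
    (map_smul p.toModel s v).trans_le (mul_nonpos_of_nonneg_of_nonpos hs (hv p hp))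

theorem IsClosedConvexCone.prod_pi {ι E : Type*} {V : ι → Type*} [NormedAddCommGroup E]
    [NormedSpace ℝ E] [Fintype ι] [∀ i, NormedAddCommGroup (V i)] [∀ i, NormedSpace ℝ (V i)]
    {T : Set E} {C : ∀ i, Set (V i)} (hT : IsClosedConvexCone T)
    (hC : ∀ i, IsClosedConvexCone (C i)) : IsClosedConvexCone (T ×ˢ univ.pi C) where
  isClosed := hT.isClosed.prod (isClosed_set_pi fun i _ => (hC i).isClosed)
  zero_mem := ⟨hT.zero_mem, fun i _ => (hC i).zero_mem⟩
  add_mem := fun _ hv _ hw => ⟨hT.add_mem _ hv.1 _ hw.1, fun i hi =>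
    (hC i).add_mem _ (hv.2 i hi) _ (hw.2 i hi)⟩
  smul_mem := fun s hs _ hv => ⟨hT.smul_mem s hs _ hv.1, fun i hi =>
    (hC i).smul_mem s hs _ (hv.2 i hi)⟩

/-- Minkowski's inequality from Cauchy–Schwarz; it makes Δ times the product norm subadditive. -/
theorem sqrt_add_le_of_bilin {V : Type*} [AddCommGroup V] [Module ℝ V]
    (B : LinearMap.BilinForm ℝ V) (hs : ∀ x y, B x y = B y x) (hp : ∀ x, 0 ≤ B x x) (v w : V) :
    √(B (v + w) (v + w)) ≤ √(B v v) + √(B w w) := by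
  have h1 : (B v w) ^ 2 ≤ B v v * B w w :=
    B.apply_sq_le_of_symm hp ⟨fun x y => hs x y⟩ v w
  have h2 : B v w ≤ √(B v v) * √(B w w) := by
    rw [← Real.sqrt_mul (hp v)]
    exact Real.le_sqrt_of_sq_le h1
  refine Real.sqrt_le_iff.2 ⟨by positivity, ?_⟩
  have h3 : B (v + w) (v + w) = B v v + 2 * B v w + B w w := by
    simp only [map_add, LinearMap.add_apply, hs w v]; ring
  rw [h3, add_sq, Real.sq_sqrt (hp v), Real.sq_sqrt (hp w)]
  linarith

/-- The sum of a bilinear form on `E` and bilinear forms on the `V i`. -/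
noncomputable def sumBilin {ι E : Type*} {V : ι → Type*} [NormedAddCommGroup E]
    [NormedSpace ℝ E] [Fintype ι] [∀ i, NormedAddCommGroup (V i)] [∀ i, NormedSpace ℝ (V i)]
    (G : E →L[ℝ] E →L[ℝ] ℝ) (GV : ∀ i, V i →L[ℝ] V i →L[ℝ] ℝ) :
    LinearMap.BilinForm ℝ (E × (∀ i, V i)) :=
  LinearMap.mk₂ ℝ (fun x y => G x.1 y.1 + ∑ i, GV i (x.2 i) (y.2 i))
    (fun x y z => by simp [Finset.sum_add_distrib]; ring)
    (fun c x y => by simp [Finset.mul_sum, mul_add])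
    (fun x y z => by simp [Finset.sum_add_distrib]; ring)
    (fun c x y => by simp [Finset.mul_sum, mul_add])

end Cones

/-! ### The adjoint equation and the costates in charts. -/

namespace ControlProblem

variable {n : ℕ} {EQ : Type*} [NormedAddCommGroup EQ] [NormedSpace ℝ EQ]
  {Q : Type*} [TopologicalSpace Q] [ChartedSpace EQ Q]
  {EU : Fin n → Type*} [∀ i, NormedAddCommGroup (EU i)] [∀ i, NormedSpace ℝ (EU i)]
  {U : Fin n → Type*} [∀ i, TopologicalSpace (U i)] [∀ i, ChartedSpace (EU i) (U i)]
  (P : ControlProblem n Q U) (q₀ : Q) (u : ∀ i, U i)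

/-- Summation by parts along the adjoint equation. -/
theorem exists_adjoint_solution (a : Fin (n + 1) → EQ →L[ℝ] ℝ) :
    ∃ p : Fin (n + 1) → EQ →L[ℝ] ℝ, -p (Fin.last n) = a (Fin.last n) ∧
      (∀ i : Fin n, p i.castSucc = -a i.castSucc + (p i.succ).comp (P.DqFModel EQ q₀ u i)) ∧
      ∀ x : EQ × (∀ i, EU i), a (Fin.last n) (P.stateDeriv EQ EU q₀ u (Fin.last n) x) +
        ∑ i : Fin n, a i.castSucc (P.stateDeriv EQ EU q₀ u i.castSucc x) =
          -p 0 x.1 - ∑ i : Fin n, p i.succ (P.DuFModel EQ EU q₀ u i (x.2 i)) := by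
  let p : Fin (n + 1) → EQ →L[ℝ] ℝ := fun j =>
    Fin.reverseInduction (motive := fun _ => EQ →L[ℝ] ℝ) (-a (Fin.last n))
      (fun i pi => -a i.castSucc + pi.comp (P.DqFModel EQ q₀ u i)) j
  have hlast : p (Fin.last n) = -a (Fin.last n) := by simp [p]
  have hstep : ∀ i : Fin n,
      p i.castSucc = -a i.castSucc + (p i.succ).comp (P.DqFModel EQ q₀ u i) := fun i => by
    simp only [p]; rw [Fin.reverseInduction_castSucc]
  refine ⟨p, by simp [hlast], hstep, fun x => ?_⟩
  -- The adjoint equation turns each summand into a telescoping difference minus a control term.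
  have h1 : ∀ i : Fin n, a i.castSucc (P.stateDeriv EQ EU q₀ u i.castSucc x) =
      (p i.succ (P.stateDeriv EQ EU q₀ u i.succ x) -
        p i.castSucc (P.stateDeriv EQ EU q₀ u i.castSucc x)) -
      p i.succ (P.DuFModel EQ EU q₀ u i (x.2 i)) := fun i => by
    rw [hstep i, stateDeriv_succ]
    simp
    ring
  have h2 := Fin.sum_univ_succ fun j => p j (P.stateDeriv EQ EU q₀ u j x)
  have h3 := Fin.sum_univ_castSucc fun j => p j (P.stateDeriv EQ EU q₀ u j x)
  rw [Finset.sum_congr rfl fun i _ => h1 i, Finset.sum_sub_distrib, Finset.sum_sub_distrib]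
  rw [stateDeriv_zero] at h2
  have h4 : a (Fin.last n) (P.stateDeriv EQ EU q₀ u (Fin.last n) x) =
      -p (Fin.last n) (P.stateDeriv EQ EU q₀ u (Fin.last n) x) := by simp [hlast]
  rw [h4]
  linarith

variable [FiniteDimensional ℝ EQ] [∀ i, FiniteDimensional ℝ (EU i)]

/-- The costates of a problem that is critical along curves, read in the preferred charts. -/
theorem exists_costates
    (hF : ∀ i, ContMDiff (𝓘(ℝ, EQ).prod 𝓘(ℝ, EU i)) 𝓘(ℝ, EQ) 1 (P.F i))
    (hL : ∀ i, LipschitzInChartAt (𝓘(ℝ, EQ).prod 𝓘(ℝ, EU i)) (P.L i)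
      (P.state q₀ u i.castSucc, u i))
    (hℓ : LipschitzInChartAt 𝓘(ℝ, EQ) P.ℓ (P.state q₀ u (Fin.last n)))
    (hκ : LipschitzInChartAt 𝓘(ℝ, EQ) P.κ q₀)
    {T : Set EQ} (hT : IsClosedConvexCone T) {C : ∀ i, Set (EU i)}
    (hC : ∀ i, IsClosedConvexCone (C i))
    {G : EQ →L[ℝ] EQ →L[ℝ] ℝ} (hGs : ∀ v w, G v w = G w v) (hGp : ∀ v, 0 ≤ G v v)
    {GU : ∀ i, EU i →L[ℝ] EU i →L[ℝ] ℝ} (hGUs : ∀ i v w, GU i v w = GU i w v)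
    (hGUp : ∀ i v, 0 ≤ GU i v v) {Δ : ℝ} (hΔ : 0 ≤ Δ)
    (hcrit : ∀ w ∈ T, ∀ v : ∀ i, EU i, (∀ i, v i ∈ C i) →
      ∃ (cQ : ℝ → Q) (cU : ∀ i, ℝ → U i),
      HasMFDerivTo 𝓘(ℝ, ℝ) 𝓘(ℝ, EQ) cQ 0 q₀ (.toSpanSingleton ℝ w) ∧
      (∀ i, HasMFDerivTo 𝓘(ℝ, ℝ) 𝓘(ℝ, EU i) (cU i) 0 (u i) (.toSpanSingleton ℝ (v i))) ∧
      ((-Δ * √(G w w + ∑ i, GU i (v i) (v i)) : ℝ) : EReal) ≤ liminf (fun t : ℝ =>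
        (((P.cost (cQ t, fun i => cU i t) - P.cost (q₀, u)) / t : ℝ) : EReal)) (𝓝[>] 0)) :
    ∃ (a p : Fin (n + 1) → EQ →L[ℝ] ℝ) (b : ∀ i, EU i →L[ℝ] ℝ) (β : EQ →L[ℝ] ℝ),
      IsLimitingSubgradient (P.ℓ ∘ (extChartAt 𝓘(ℝ, EQ) (P.state q₀ u (Fin.last n))).symm)
        (extChartAt 𝓘(ℝ, EQ) (P.state q₀ u (Fin.last n)) (P.state q₀ u (Fin.last n)))
        (a (Fin.last n)) ∧
      (∀ i : Fin n, IsLimitingSubgradient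
        (P.L i ∘ (extChartAt (𝓘(ℝ, EQ).prod 𝓘(ℝ, EU i)) (P.state q₀ u i.castSucc, u i)).symm)
        (extChartAt (𝓘(ℝ, EQ).prod 𝓘(ℝ, EU i)) (P.state q₀ u i.castSucc, u i)
          (P.state q₀ u i.castSucc, u i)) ((a i.castSucc).coprod (b i))) ∧
      -p (Fin.last n) = a (Fin.last n) ∧
      (∀ i : Fin n, p i.castSucc = -a i.castSucc + (p i.succ).comp (P.DqFModel EQ q₀ u i)) ∧
      (∀ i : Fin n, ∀ v ∈ C i,
        -Δ * √(GU i v v) ≤ b i v - p i.succ (P.DuFModel EQ EU q₀ u i v)) ∧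
      IsLimitingSubgradient (P.κ ∘ (extChartAt 𝓘(ℝ, EQ) q₀).symm) (extChartAt 𝓘(ℝ, EQ) q₀ q₀) β ∧
      ∀ w ∈ T, -Δ * √(G w w) ≤ β w - p 0 w := by
  have hK := hT.prod_pi hC
  have hB : ∀ x, sumBilin G GU x x = G x.1 x.1 + ∑ i, GU i (x.2 i) (x.2 i) := fun x => rfl
  obtain ⟨β, α, a, b, hβ, hα, hab, hst⟩ := P.exists_limitingSubgradients q₀ u hF hL hℓ hκ
    hK.isClosed hK.zero_mem hK.add_mem hK.smul_mem
    (N := fun x => Δ * √(sumBilin G GU x x))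
    (by
      simp only [hB]
      refine continuous_const.mul (Real.continuous_sqrt.comp ?_)
      fun_prop)
    (fun v w => by
      rw [← mul_add]
      refine mul_le_mul_of_nonneg_left (sqrt_add_le_of_bilin _ (fun x y => ?_) (fun x => ?_) v w) hΔ
      · simp [sumBilin, hGs x.1 y.1, hGUs _ (x.2 _) (y.2 _)]
      · rw [hB]
        exact add_nonneg (hGp _) (Finset.sum_nonneg fun i _ => hGUp i _))
    (fun s hs v => by
      rw [map_smul, map_smul, LinearMap.smul_apply, smul_eq_mul, smul_eq_mul, ← mul_assoc,
        Real.sqrt_mul (mul_self_nonneg s), Real.sqrt_mul_self hs]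
      ring)
    (fun x hx => by
      simpa only [neg_mul, hB] using hcrit x.1 hx.1 x.2 fun i => hx.2 i (mem_univ i))
  obtain ⟨p, hp1, hp2, hp3⟩ := P.exists_adjoint_solution q₀ u (EU := EU)
    (Fin.snoc (α := fun _ => EQ →L[ℝ] ℝ) a α)
  have hst' : ∀ x ∈ T ×ˢ univ.pi C, -Δ * √(sumBilin G GU x x) ≤ (β x.1 - p 0 x.1) +
      ∑ i, (b i (x.2 i) - p i.succ (P.DuFModel EQ EU q₀ u i (x.2 i))) := fun x hx => by
    have h1 := hst x hx
    have h2 := hp3 x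
    simp only [Fin.snoc_last, Fin.snoc_castSucc] at h2
    rw [Finset.sum_add_distrib] at h1
    rw [Finset.sum_sub_distrib]
    linarith
  refine ⟨Fin.snoc (α := fun _ => EQ →L[ℝ] ℝ) a α, p, b, β, by simpa using hα, by simpa using hab,
    hp1, hp2, fun i v hv => ?_, hβ, fun w hw => ?_⟩
  -- On a vector with a single nonzero component the product norm reduces to the norm of that
  -- factor.
  · have h1 := hst' (0, Pi.single i v) ⟨hT.zero_mem, fun j _ => by
      rcases eq_or_ne j i with rfl | hj
      · simpa using hv
      · simpa [hj] using (hC j).zero_mem⟩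
    have h2 : sumBilin G GU (0, Pi.single i v) (0, Pi.single i v) = GU i v v := by
      rw [hB, Finset.sum_eq_single i]
      · simp
      · intro j _ hj; simp [hj]
      · simp
    rw [h2, Finset.sum_eq_single i] at h1
    · simpa using h1
    · intro j _ hj; simp [hj]
    · simp
  · have h1 := hst' (w, 0) ⟨hw, fun j _ => (hC j).zero_mem⟩
    have h2 : sumBilin G GU (w, 0) (w, 0) = G w w := by rw [hB]; simp
    rw [h2] at h1
    simpa using h1

end ControlProblem

/-! ### Freezing the first stage cost, and the return to the manifold. -/

section Slices

variable {E : Type*} [NormedAddCommGroup E] [NormedSpace ℝ E] {H : Type*} [TopologicalSpace H]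
  {I : ModelWithCorners ℝ E H} {M : Type*} [TopologicalSpace M] [ChartedSpace H M]
  {E' : Type*} [NormedAddCommGroup E'] [NormedSpace ℝ E'] {H' : Type*} [TopologicalSpace H']
  {I' : ModelWithCorners ℝ E' H'} {M' : Type*} [TopologicalSpace M'] [ChartedSpace H' M']

theorem LipschitzInChartAt.slice {f : M × M' → ℝ} {q : M} {c : M'}
    (h : LipschitzInChartAt (I.prod I') f (q, c)) :
    LipschitzInChartAt I' (fun c => f (q, c)) c := by
  obtain ⟨K, s, hs, hK⟩ := h
  have hc : Continuous fun y : E' => (extChartAt I q q, y) := by fun_prop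
  rw [extChartAt_prod] at hs
  refine ⟨K * 1, _, hc.continuousAt.preimage_mem_nhds hs, ?_⟩
  have hl : LipschitzOnWith 1 (fun y : E' => (extChartAt I q q, y))
      ((fun y : E' => (extChartAt I q q, y)) ⁻¹' s) := (LipschitzWith.prodMk_left _).lipschitzOnWith
  have h1 := hK.comp hl fun y hy => hy
  intro y hy y' hy'
  have h2 := h1 hy hy'
  simpa only [extChartAt_prod, Function.comp_apply, PartialEquiv.prod_symm, PartialEquiv.prod_coe,
    extChartAt_to_inv] using h2

theorem LipschitzInChartAt.comp_snd {f : M' → ℝ} {c : M'} (h : LipschitzInChartAt I' f c) (q : M) :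
    LipschitzInChartAt (I.prod I') (fun z : M × M' => f z.2) (q, c) :=
  LipschitzNear.comp_clm (ContinuousLinearMap.snd ℝ E E')
    (x := extChartAt (I.prod I') (q, c) (q, c)) h

end Slices

namespace ControlProblem

theorem state_castSucc_of_val_eq_zero {n : ℕ} {Q : Type*} {U : Fin n → Type*}
    (P : ControlProblem n Q U) (q₀ : Q) (u : ∀ i, U i) {i : Fin n} (hi : i.val = 0) :
    P.state q₀ u i.castSucc = q₀ := by
  have : i.castSucc = 0 := Fin.ext hi
  rw [this]
  rfl

/-- The problem in which the first stage cost is frozen at the initial state `q₀`. -/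
def freezeFirst {n : ℕ} {Q : Type*} {U : Fin n → Type*} (P : ControlProblem n Q U) (q₀ : Q) :
    ControlProblem n Q U :=
  { P with L := fun i z => if i.val = 0 then P.L i (q₀, z.2) else P.L i z }

/-- The two costs agree when the initial state is the freezing point, so variations of the controls
alone cannot distinguish the two problems. -/
theorem cost_freezeFirst {n : ℕ} {Q : Type*} {U : Fin n → Type*} (P : ControlProblem n Q U)
    (q₀ : Q) (u : ∀ i, U i) : (P.freezeFirst q₀).cost (q₀, u) = P.cost (q₀, u) := by
  refine congrArg (P.κ q₀ + P.ℓ (P.state q₀ u (Fin.last n)) + ·) (Finset.sum_congr rfl fun i _ => ?_)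
  by_cases hi : i.val = 0
  · simp only [freezeFirst, hi, if_true, P.state_castSucc_of_val_eq_zero q₀ u hi]
  · simp only [freezeFirst, hi, if_false]
    rfl

variable {n : ℕ} {EQ : Type*} [NormedAddCommGroup EQ] [NormedSpace ℝ EQ]
  {Q : Type*} [TopologicalSpace Q] [ChartedSpace EQ Q] [IsManifold 𝓘(ℝ, EQ) ∞ Q]
  {EU : Fin n → Type*} [∀ i, NormedAddCommGroup (EU i)] [∀ i, NormedSpace ℝ (EU i)]
  {U : Fin n → Type*} [∀ i, TopologicalSpace (U i)] [∀ i, ChartedSpace (EU i) (U i)] [∀ i, IsManifold 𝓘(ℝ, EU i) ∞ (U i)]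
  {P : ControlProblem n Q U} {gQ : SmoothMetric EQ Q} {g : ∀ i, SmoothMetric (EU i) (U i)}
  {Δ : ℝ} {q₀ : Q} {u : ∀ i, U i}

/-- Criticality, tested along a curve with components `cQ` and `cU i`. -/
theorem IsCritical.le_liminf (hcrit : P.IsCritical gQ g Δ q₀ u) (hu : u ∈ P.controls) {w : EQ}
    (hw : w ∈ clarkeTangentCone 𝓘(ℝ, EQ) P.S q₀) {v : ∀ i, EU i}
    (hv : ∀ i, v i ∈ clarkeTangentCone 𝓘(ℝ, EU i) (P.controlSet i) (u i))
    {cQ : ℝ → Q} {cU : ∀ i, ℝ → U i}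
    (hQs : ContMDiff 𝓘(ℝ, ℝ) 𝓘(ℝ, EQ) ∞ cQ) (hUs : ∀ i, ContMDiff 𝓘(ℝ, ℝ) 𝓘(ℝ, EU i) ∞ (cU i))
    (hQ : HasMFDerivTo 𝓘(ℝ, ℝ) 𝓘(ℝ, EQ) cQ 0 q₀ (.toSpanSingleton ℝ w))
    (hU : ∀ i, HasMFDerivTo 𝓘(ℝ, ℝ) 𝓘(ℝ, EU i) (cU i) 0 (u i) (.toSpanSingleton ℝ (v i))) :
    ((-Δ * √(gQ.inner q₀ w w + ∑ i, (g i).inner (u i) (v i) (v i)) : ℝ) : EReal) ≤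
      liminf (fun t : ℝ => (((P.cost (cQ t, fun i => cU i t) - P.cost (q₀, u)) / t : ℝ) : EReal))
        (𝓝[>] 0) := by
  have h1 := hcrit w hw v (mem_clarkeTangentCone_pi (I := fun i => 𝓘(ℝ, EU i)) hu hv)
  exact le_liminf_of_le_lowerDini h1 (hQs.prodMk (contMDiff_pi (f := fun t i => cU i t) hUs))
    (hQ.prodMk (HasMFDerivTo.pi (f := cU) hU))

variable [FiniteDimensional ℝ EQ] [T2Space Q]

/-- Tangent spaces are the model spaces by definition, so only the two subgradient conditions have
to be transferred from charts. -/
theorem costateConditions_of_model (hP : P.Regular EQ EU)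
    {a p : Fin (n + 1) → EQ →L[ℝ] ℝ} {b : ∀ i, EU i →L[ℝ] ℝ} {β : EQ →L[ℝ] ℝ}
    (ha : IsLimitingSubgradient
        (P.ℓ ∘ (extChartAt 𝓘(ℝ, EQ) (P.state q₀ u (Fin.last n))).symm)
        (extChartAt 𝓘(ℝ, EQ) (P.state q₀ u (Fin.last n)) (P.state q₀ u (Fin.last n)))
        (a (Fin.last n)))
    (hend : -p (Fin.last n) = a (Fin.last n))
    (hadj : ∀ i : Fin n, p i.castSucc = -a i.castSucc + (p i.succ).comp (P.DqFModel EQ q₀ u i))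
    (hst : ∀ i : Fin n, ∀ v ∈ clarkeTangentCone 𝓘(ℝ, EU i) (P.controlSet i) (u i),
      -Δ * √((g i).inner (u i) v v) ≤ b i v - p i.succ (P.DuFModel EQ EU q₀ u i v))
    (hβ : IsLimitingSubgradient (P.κ ∘ (extChartAt 𝓘(ℝ, EQ) q₀).symm)
      (extChartAt 𝓘(ℝ, EQ) q₀ q₀) β)
    (hinit : ∀ w ∈ clarkeTangentCone 𝓘(ℝ, EQ) P.S q₀, -Δ * √(gQ.inner q₀ w w) ≤ β w - p 0 w) :
    P.CostateConditions gQ g Δ q₀ u a b p β where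
  a_last := mem_limitingSubdiffReal_of_isLimitingSubgradient
    (hP.lipschitz_ℓ.lipschitzInChartAt _).continuousAt ha
  endpoint := hend
  adjoint := hadj
  stationary := hst
  β_mem := mem_limitingSubdiffReal_of_isLimitingSubgradient
    (hP.lipschitz_κ.lipschitzInChartAt _).continuousAt hβ
  initial := hinit

theorem metric_nonneg {E : Type*} [NormedAddCommGroup E] [NormedSpace ℝ E] {M : Type*}
    [TopologicalSpace M] [ChartedSpace E M] [IsManifold 𝓘(ℝ, E) ∞ M] (G : SmoothMetric E M)
    (q : M) (v : E) : 0 ≤ (G.inner q : E →L[ℝ] E →L[ℝ] ℝ) v v := by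
  rcases eq_or_ne v 0 with rfl | hv
  · exact (map_zero (G.inner q (0 : E) : E →L[ℝ] ℝ)).ge
  · exact (G.pos q v hv).le

variable [∀ i, FiniteDimensional ℝ (EU i)] [∀ i, T2Space (U i)]

theorem exists_costateConditions (hP : P.Regular EQ EU) (hΔ : 0 ≤ Δ) (hu : u ∈ P.controls)
    (hcrit : P.IsCritical gQ g Δ q₀ u) :
    ∃ a b p β, P.CostateConditions gQ g Δ q₀ u a b p β ∧
      ∀ i : Fin n, pairCovector (a i.castSucc) (b i) ∈
        limitingSubdiffReal (𝓘(ℝ, EQ).prod 𝓘(ℝ, EU i)) (P.L i)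
          (P.state q₀ u i.castSucc, u i) := by
  obtain ⟨a, p, b, β, ha, hab, hend, hadj, hst, hβ, hinit⟩ := P.exists_costates q₀ u hP.contMDiff_F
    (fun i => (hP.lipschitz_L i).lipschitzInChartAt _) (hP.lipschitz_ℓ.lipschitzInChartAt _)
    (hP.lipschitz_κ.lipschitzInChartAt _)
    (isClosedConvexCone_clarkeTangentCone 𝓘(ℝ, EQ) P.S q₀)
    (fun i => isClosedConvexCone_clarkeTangentCone 𝓘(ℝ, EU i) (P.controlSet i) (u i))
    (G := gQ.inner q₀) (gQ.symm q₀) (metric_nonneg gQ q₀)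
    (GU := fun i => (g i).inner (u i)) (fun i => (g i).symm (u i))
    (fun i => metric_nonneg (g i) (u i)) hΔ fun w hw v hv => by
      obtain ⟨cQ, hQs, hQ⟩ := exists_contMDiff_curve (I := 𝓘(ℝ, EQ)) q₀ w
      choose cU hUs hU using fun i => exists_contMDiff_curve (I := 𝓘(ℝ, EU i)) (u i) (v i)
      exact ⟨cQ, cU, hQ, hU, hcrit.le_liminf hu hw hv hQs hUs hQ hU⟩
  exact ⟨a, b, p, β, costateConditions_of_model hP ha hend hadj hst hβ hinit, fun i =>
    mem_limitingSubdiffReal_of_isLimitingSubgradient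
      ((hP.lipschitz_L i).lipschitzInChartAt _).continuousAt (hab i)⟩

/-- The frozen L_0 depends on the control alone, so its limiting subgradients restrict to partial
ones. The freedom in a_0 pays for keeping the initial state fixed. -/
theorem exists_costateConditions_partial (hP : P.Regular EQ EU) (hΔ : 0 ≤ Δ) (hu : u ∈ P.controls)
    (hcrit : P.IsCritical gQ g Δ q₀ u) :
    ∃ a b p β, P.CostateConditions gQ g Δ q₀ u a b p β ∧
      (∀ i : Fin n, i.val = 0 → b i ∈
        limitingSubdiffReal 𝓘(ℝ, EU i) (fun c => P.L i (P.state q₀ u i.castSucc, c)) (u i)) ∧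
      ∀ i : Fin n, i.val ≠ 0 → pairCovector (a i.castSucc) (b i) ∈
        limitingSubdiffReal (𝓘(ℝ, EQ).prod 𝓘(ℝ, EU i)) (P.L i)
          (P.state q₀ u i.castSucc, u i) := by
  rcases Nat.eq_zero_or_pos n with hn | hn
  · obtain ⟨a, b, p, β, h, -⟩ := exists_costateConditions hP hΔ hu hcrit
    exact ⟨a, b, p, β, h, fun i => absurd i.isLt (by omega), fun i => absurd i.isLt (by omega)⟩
  have hL : ∀ i, LipschitzInChartAt (𝓘(ℝ, EQ).prod 𝓘(ℝ, EU i)) ((P.freezeFirst q₀).L i)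
      (P.state q₀ u i.castSucc, u i) := fun i => by
    by_cases hi : i.val = 0
    · have h1 := ((hP.lipschitz_L i).lipschitzInChartAt (q₀, u i)).slice.comp_snd (I := 𝓘(ℝ, EQ))
        (P.state q₀ u i.castSucc)
      simpa only [freezeFirst, hi, if_true] using h1
    · simpa only [freezeFirst, hi, if_false] using (hP.lipschitz_L i).lipschitzInChartAt _
  have h0S := (isClosedConvexCone_clarkeTangentCone 𝓘(ℝ, EQ) P.S q₀).zero_mem
  -- The cone {0} for the initial direction restricts the test curves to a constant initial state,
  -- where freezing changes nothing.
  obtain ⟨a, p, b, β, ha, hab, hend, hadj, hst, hβ, -⟩ := (P.freezeFirst q₀).exists_costates q₀ u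
    hP.contMDiff_F hL (hP.lipschitz_ℓ.lipschitzInChartAt _)
    (hP.lipschitz_κ.lipschitzInChartAt _) isClosedConvexCone_zero
    (fun i => isClosedConvexCone_clarkeTangentCone 𝓘(ℝ, EU i) (P.controlSet i) (u i))
    (G := gQ.inner q₀) (gQ.symm q₀) (metric_nonneg gQ q₀)
    (GU := fun i => (g i).inner (u i)) (fun i => (g i).symm (u i))
    (fun i => metric_nonneg (g i) (u i)) hΔ fun w hw v hv => by
      obtain rfl : w = 0 := hw
      choose cU hUs hU using fun i => exists_contMDiff_curve (I := 𝓘(ℝ, EU i)) (u i) (v i)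
      have hQ : HasMFDerivTo 𝓘(ℝ, ℝ) 𝓘(ℝ, EQ) (fun _ : ℝ => q₀) 0 q₀
          (.toSpanSingleton ℝ (0 : EQ)) := by
        rw [ContinuousLinearMap.toSpanSingleton_zero]
        exact hasMFDerivTo_const 0 q₀
      refine ⟨fun _ => q₀, cU, hQ, hU, ?_⟩
      simp only [cost_freezeFirst]
      exact hcrit.le_liminf hu h0S hv contMDiff_const hUs hQ hU
  let i₀ : Fin n := ⟨0, hn⟩
  have hlast : Fin.last n ≠ 0 := fun h => hn.ne' (congrArg Fin.val h)
  have hcs : ∀ i : Fin n, i.val ≠ 0 → i.castSucc ≠ 0 := fun i hi h => hi (congrArg Fin.val h)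
  -- With p_0 replaced by β the initial condition reads -Δ ‖w‖ ≤ 0, and a_0 is read off from the
  -- first adjoint equation. As n ≥ 1, the endpoint condition is not at index 0; the stationarity
  -- conditions involve only p_1, …, p_n.
  obtain ⟨a', ha0, ha'⟩ : ∃ a' : Fin (n + 1) → EQ →L[ℝ] ℝ,
      a' 0 = (p i₀.succ).comp (P.DqFModel EQ q₀ u i₀) - β ∧ ∀ j ≠ 0, a' j = a j :=
    ⟨Function.update a 0 _, Function.update_self .., fun j hj => Function.update_of_ne hj ..⟩
  obtain ⟨p', hp0, hp'⟩ : ∃ p' : Fin (n + 1) → EQ →L[ℝ] ℝ, p' 0 = β ∧ ∀ j ≠ 0, p' j = p j :=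
    ⟨Function.update p 0 _, Function.update_self .., fun j hj => Function.update_of_ne hj ..⟩
  refine ⟨a', b, p', β, costateConditions_of_model hP ?_ ?_ ?_ ?_ hβ ?_, ?_, ?_⟩
  · rw [ha' _ hlast]
    exact ha
  · rw [ha' _ hlast, hp' _ hlast]
    exact hend
  · intro i
    rw [hp' _ (Fin.succ_ne_zero i)]
    by_cases hi : i.val = 0
    · obtain rfl : i = i₀ := Fin.ext hi
      have : i₀.castSucc = 0 := rfl
      rw [this, ha0, hp0]
      abel
    · rw [ha' _ (hcs i hi), hp' _ (hcs i hi)]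
      exact hadj i
  · intro i
    rw [hp' _ (Fin.succ_ne_zero i)]
    exact hst i
  · intro w _
    rw [hp0, sub_self, neg_mul]
    exact neg_nonpos.2 (mul_nonneg hΔ (Real.sqrt_nonneg _))
  · intro i hi
    refine mem_limitingSubdiffReal_of_isLimitingSubgradient
      ((hP.lipschitz_L i).lipschitzInChartAt (P.state q₀ u i.castSucc, u i)).slice.continuousAt ?_
    have h1 := (hab i).restrict (f₁ := (fun c => P.L i (P.state q₀ u i.castSucc, c)) ∘
      (extChartAt 𝓘(ℝ, EU i) (u i)).symm) (pr := .snd ℝ EQ (EU i)) (i := .inr ℝ EQ (EU i))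
      fun x h => by
        simp only [freezeFirst, hi, if_true, P.state_castSucc_of_val_eq_zero q₀ u hi]
        rfl
    rwa [ContinuousLinearMap.coprod_comp_inr] at h1
  · intro i hi
    refine mem_limitingSubdiffReal_of_isLimitingSubgradient
      ((hP.lipschitz_L i).lipschitzInChartAt _).continuousAt ?_
    have h1 := hab i
    simp only [freezeFirst, hi, if_false] at h1
    rw [ha' _ (hcs i hi)]
    exact h1

end ControlProblem

end DiscreteGeometricControl

theorem mainTheorem2 {n : ℕ}
    {EQ : Type*} [NormedAddCommGroup EQ] [NormedSpace ℝ EQ] [FiniteDimensional ℝ EQ]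
    {Q : Type*} [TopologicalSpace Q] [T2Space Q] [ChartedSpace EQ Q] [IsManifold 𝓘(ℝ, EQ) ∞ Q]
    {EU : Fin n → Type*} [∀ i, NormedAddCommGroup (EU i)] [∀ i, NormedSpace ℝ (EU i)]
    [∀ i, FiniteDimensional ℝ (EU i)]
    {U : Fin n → Type*} [∀ i, TopologicalSpace (U i)] [∀ i, T2Space (U i)]
    [∀ i, ChartedSpace (EU i) (U i)] [∀ i, IsManifold 𝓘(ℝ, EU i) ∞ (U i)]
    (gQ : DiscreteGeometricControl.SmoothMetric EQ Q)
    (g : ∀ i, DiscreteGeometricControl.SmoothMetric (EU i) (U i))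
    (P : DiscreteGeometricControl.ControlProblem n Q U) (hP : P.Regular EQ EU)
    (Δ : ℝ) (hΔ : 0 ≤ Δ) (q₀ : Q) (hq₀ : q₀ ∈ P.S) (u : ∀ i, U i) (hu : u ∈ P.controls)
    (hcrit : P.IsCritical gQ g Δ q₀ u) :
    (∃ a b p β, P.CostateConditions gQ g Δ q₀ u a b p β ∧
      ∀ i : Fin n, DiscreteGeometricControl.ControlProblem.pairCovector (a i.castSucc) (b i) ∈
        DiscreteGeometricControl.limitingSubdiffReal (𝓘(ℝ, EQ).prod 𝓘(ℝ, EU i)) (P.L i)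
          (P.state q₀ u i.castSucc, u i)) ∧
    (∃ a b p β, P.CostateConditions gQ g Δ q₀ u a b p β ∧
      (∀ i : Fin n, i.val = 0 → b i ∈
        DiscreteGeometricControl.limitingSubdiffReal 𝓘(ℝ, EU i)
          (fun c => P.L i (P.state q₀ u i.castSucc, c)) (u i)) ∧
      ∀ i : Fin n, i.val ≠ 0 →
        DiscreteGeometricControl.ControlProblem.pairCovector (a i.castSucc) (b i) ∈
          DiscreteGeometricControl.limitingSubdiffReal (𝓘(ℝ, EQ).prod 𝓘(ℝ, EU i)) (P.L i)
            (P.state q₀ u i.castSucc, u i)) :=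
  ⟨DiscreteGeometricControl.ControlProblem.exists_costateConditions hP hΔ hu hcrit,
    DiscreteGeometricControl.ControlProblem.exists_costateConditions_partial hP hΔ hu hcrit⟩
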